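/- Let $L_1, L_2, \nu > 0$, $T^+, T^- \in \mathbb{R}$ and $\Delta T := T^+ - T^-$. On the cylinder $x=(x_1,x_2) \in [0,L_1]\times \mathbb{R}/L_2\mathbb{Z}$ consider the viscous two-fluid system $$\partial_t \rho^{\pm} = T^{\pm}\,\partial_{x_2}\rho^{\pm} - E^{\perp}\cdot\nabla\rho^{\pm} + \nu\nabla^2\rho^{\pm},\qquad E=-\nabla V,\qquad -\nabla^2 V = \rho^+ + \rho^- - 1,$$ where $E^\perp = (E_2,-E_1)$, with the Dirichlet conditions $V = 0$ and $\rho^\pm = \rho_{ss}^\pm$ at $x_1 = 0, L_1$, where $\rho_{ss}^+(x) := 1 - x_1/L_1$ and $\rho_{ss}^-(x) := x_1/L_1$. A solution on $[0,T)$, $0<T\le\infty$, is a pair $\rho=(\rho^+,\rho^-)$, together with $V$, such that $t\mapsto\rho^\pm(t)$ is continuous on $[0,T)$ and differentiable on $(0,T)$ with values in $L^2$ and such that, for every $t\in(0,T)$, $\rho^\pm(t), V(t)\in H^2$, $\rho^\pm(t)-\rho_{ss}^\pm, V(t)\in H^1_0$, and the equations hold almost everywhere; the initial data $\rho(0)$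 are arbitrary in $L^2$. Put $\|\rho-\rho_{ss}\|_{L^2}^2 := \|\rho^+-\rho_{ss}^+\|_{L^2}^2+\|\rho^--\rho_{ss}^-\|_{L^2}^2$. Suppose that $\Delta T < 0$ or $\Delta T > \Delta T_* := 4L_1/\pi^2$. Then $\rho_{ss}=(\rho^+_{ss},\rho^-_{ss})$, with $V=0$, is a steady state that is globally asymptotically stable in $L^2$: 1. it is Lyapunov stable: for every $\varepsilon>0$ there is $\delta>0$ such that every solution on any interval $[0,T)$ with $\|\rho(0)-\rho_{ss}\|_{L^2}^2<\delta$ satisfies $\|\rho(t)-\rho_{ss}\|_{L^2}^2<\varepsilon$ for all $t\in[0,T)$; 2. every solution on $[0,\infty)$ satisfies $\|\rho(t)-\rho_{ss}\|_{L^2}\to 0$ as $t\to\infty$. Moreover, the squared distance decays exponentially at the rate $2\pi^2\nu/L_1^2$: there is a constant $C>0$, depending only on $L_1$ and $\Delta T$, such that every solution on any interval $[0,T)$ satisfies $$\|\rho(t)-\rho_{ss}\|_{L^2}^2 \le C\,\|\rho(0)-\rho_{ss}\|_{L^2}^2\,\exp\!\left(-\frac{2\pi^2\nu}{L_1^2}\,t\right)\qquad\text{for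 all } t\in[0,T).$$ -/

import Mathlib

open MeasureTheory Set Filter Topology
open scoped ContDiff

noncomputable section

namespace TwoFluid

/-- Lebesgue measure on the fundamental rectangle `(0, L₁) × (0, L₂)` of the cylinder
`[0, L₁] × ℝ / L₂ ℤ`. -/
abbrev cylMeasure (L₁ L₂ : ℝ) : Measure (ℝ × ℝ) :=
  (volume : Measure (ℝ × ℝ)).restrict (Ioo 0 L₁ ×ˢ Ioo 0 L₂)

/-- Real `L²` on the cylinder. -/
abbrev L2Cyl (L₁ L₂ : ℝ) : Type := Lp ℝ 2 (cylMeasure L₁ L₂)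

/-- Test functions on the open cylinder `(0, L₁) × ℝ / L₂ ℤ`, written as functions on the plane that
are `L₂`-periodic in the second variable. -/
structure IsTest (L₁ L₂ : ℝ) (φ : ℝ × ℝ → ℝ) : Prop where
  smooth : ContDiff ℝ ∞ φ
  periodic : ∀ x y : ℝ, φ (x, y + L₂) = φ (x, y)
  support : ∃ a b : ℝ, 0 < a ∧ b < L₁ ∧ ∀ x y : ℝ, φ (x, y) ≠ 0 → x ∈ Icc a b

/-- The first coordinate direction. -/
def e₁ : ℝ × ℝ := (1, 0)

/-- The second coordinate direction. -/
def e₂ : ℝ × ℝ := (0, 1)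

/-- `g` is the weak derivative of `f` on the cylinder in the direction `e`. Since the test functions
are periodic and need not vanish on `x₂ = 0, L₂`, periodicity in `x₂` is built in. -/
def HasWeakPartial {L₁ L₂ : ℝ} (e : ℝ × ℝ) (f g : L2Cyl L₁ L₂) : Prop :=
  ∀ φ : ℝ × ℝ → ℝ, IsTest L₁ L₂ φ →
    ∫ p, f p * fderiv ℝ φ p e ∂(cylMeasure L₁ L₂) = - ∫ p, g p * φ p ∂(cylMeasure L₁ L₂)

/-- The Sobolev space `H¹` of the cylinder. -/
def MemH1 {L₁ L₂ : ℝ} (f : L2Cyl L₁ L₂) : Prop :=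
  ∃ f₁ f₂ : L2Cyl L₁ L₂, HasWeakPartial e₁ f f₁ ∧ HasWeakPartial e₂ f f₂

/-- The Sobolev space `H²` of the cylinder. -/
def MemH2 {L₁ L₂ : ℝ} (f : L2Cyl L₁ L₂) : Prop :=
  ∃ f₁ f₂ : L2Cyl L₁ L₂, HasWeakPartial e₁ f f₁ ∧ HasWeakPartial e₂ f f₂ ∧ MemH1 f₁ ∧ MemH1 f₂

/-- The Sobolev space `H¹₀` of the cylinder: the closure of the test functions in `H¹`. -/
def MemH10 {L₁ L₂ : ℝ} (f : L2Cyl L₁ L₂) : Prop :=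
  ∃ f₁ f₂ : L2Cyl L₁ L₂, HasWeakPartial e₁ f f₁ ∧ HasWeakPartial e₂ f f₂ ∧
    ∃ φ : ℕ → ℝ × ℝ → ℝ, (∀ n, IsTest L₁ L₂ (φ n)) ∧
      Tendsto (fun n => eLpNorm (fun p => φ n p - f p) 2 (cylMeasure L₁ L₂)) atTop (𝓝 0) ∧
      Tendsto (fun n => eLpNorm (fun p => fderiv ℝ (φ n) p e₁ - f₁ p) 2 (cylMeasure L₁ L₂))
        atTop (𝓝 0) ∧
      Tendsto (fun n => eLpNorm (fun p => fderiv ℝ (φ n) p e₂ - f₂ p) 2 (cylMeasure L₁ L₂))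
        atTop (𝓝 0)

/-- `g = ∂₁∂₁f + ∂₂∂₂f` in the weak sense, all derivatives involved being in `L²`. -/
def HasLaplacian {L₁ L₂ : ℝ} (f g : L2Cyl L₁ L₂) : Prop :=
  ∃ f₁ f₂ f₁₁ f₂₂ : L2Cyl L₁ L₂, HasWeakPartial e₁ f f₁ ∧ HasWeakPartial e₂ f f₂ ∧
    HasWeakPartial e₁ f₁ f₁₁ ∧ HasWeakPartial e₂ f₂ f₂₂ ∧ g = f₁₁ + f₂₂

lemma memLp_of_continuous (L₁ L₂ : ℝ) {f : ℝ × ℝ → ℝ} (hf : Continuous f) :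
    MemLp f 2 (cylMeasure L₁ L₂) := by
  have hK : IsCompact (Icc (0 : ℝ) L₁ ×ˢ Icc (0 : ℝ) L₂) := isCompact_Icc.prod isCompact_Icc
  obtain ⟨M, hM⟩ := hK.exists_bound_of_continuousOn hf.continuousOn
  have : IsFiniteMeasure (cylMeasure L₁ L₂) := by
    refine isFiniteMeasure_restrict.2 (ne_of_lt ?_)
    exact (measure_mono (Set.prod_mono Ioo_subset_Icc_self Ioo_subset_Icc_self)).trans_lt
      hK.measure_lt_top
  refine MemLp.of_bound hf.aestronglyMeasurable M ?_
  filter_upwards [ae_restrict_mem (measurableSet_Ioo.prod measurableSet_Ioo)] with p hp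
  exact hM p (Set.prod_mono Ioo_subset_Icc_self Ioo_subset_Icc_self hp)

/-- The steady state `ρ_ss⁺(x) = 1 - x₁ / L₁`. -/
def rhoSSPlus (L₁ L₂ : ℝ) : L2Cyl L₁ L₂ :=
  (memLp_of_continuous L₁ L₂ (f := fun p => 1 - p.1 / L₁) (by fun_prop)).toLp _

/-- The steady state `ρ_ss⁻(x) = x₁ / L₁`. -/
def rhoSSMinus (L₁ L₂ : ℝ) : L2Cyl L₁ L₂ :=
  (memLp_of_continuous L₁ L₂ (f := fun p => p.1 / L₁) (by fun_prop)).toLp _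

/-- The right-hand side of the evolution equation of one fluid at temperature `T`:
`r = T ∂₂ρ - E^⊥ · ∇ρ + ν ∇²ρ` almost everywhere, where `E^⊥ = (E₂, -E₁)`. -/
def TransportRHS {L₁ L₂ : ℝ} (ν T : ℝ) (E₁ E₂ ρ r : L2Cyl L₁ L₂) : Prop :=
  ∃ ρ₁ ρ₂ Δρ : L2Cyl L₁ L₂,
    HasWeakPartial e₁ ρ ρ₁ ∧ HasWeakPartial e₂ ρ ρ₂ ∧ HasLaplacian ρ Δρ ∧
    ∀ᵐ p ∂(cylMeasure L₁ L₂),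
      r p = T * ρ₂ p - (E₂ p * ρ₁ p + (-E₁ p) * ρ₂ p) + ν * Δρ p

/-- `V` solves `-∇²V = ρ⁺ + ρ⁻ - 1` with `V = 0` on `x₁ = 0, L₁`. -/
def IsPotential {L₁ L₂ : ℝ} (ρp ρm V : L2Cyl L₁ L₂) : Prop :=
  MemH2 V ∧ MemH10 V ∧ ∃ ΔV : L2Cyl L₁ L₂, HasLaplacian V ΔV ∧
    ∀ᵐ p ∂(cylMeasure L₁ L₂), - ΔV p = ρp p + ρm p - 1

/-- The viscous two-fluid equations with their Dirichlet conditions, at one instant: `ρ^±` are the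
densities, `dρ^±` their time derivatives and `V` is the potential. -/
structure SatisfiesAt {L₁ L₂ : ℝ} (ν Tp Tm : ℝ) (ρp ρm V dρp dρm : L2Cyl L₁ L₂) : Prop where
  regular_plus : MemH2 ρp
  regular_minus : MemH2 ρm
  boundary_plus : MemH10 (ρp - rhoSSPlus L₁ L₂)
  boundary_minus : MemH10 (ρm - rhoSSMinus L₁ L₂)
  poisson : IsPotential ρp ρm V
  evolution : ∃ E₁ E₂ : L2Cyl L₁ L₂, HasWeakPartial e₁ V (-E₁) ∧ HasWeakPartial e₂ V (-E₂) ∧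
    TransportRHS ν Tp E₁ E₂ ρp dρp ∧ TransportRHS ν Tm E₁ E₂ ρm dρm

/-- Solutions of the viscous two-fluid system on `[0, T)`, `0 < T ≤ ∞`: the initial data are
arbitrary in `L²` and attained in `L²`, and for `0 < t < T` the densities are in `H²`, differentiable
in time with values in `L²`, and satisfy the equations and boundary conditions. -/
structure IsSolution {L₁ L₂ : ℝ} (ν Tp Tm : ℝ) (T : EReal) (ρp ρm V : ℝ → L2Cyl L₁ L₂) :
    Prop where
  pos : 0 < T
  initial_plus : ContinuousWithinAt ρp (Ici 0) 0
  initial_minus : ContinuousWithinAt ρm (Ici 0) 0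
  equations : ∀ t : ℝ, 0 < t → (t : EReal) < T → ∃ dρp dρm : L2Cyl L₁ L₂,
    HasDerivAt ρp dρp t ∧ HasDerivAt ρm dρm t ∧
    SatisfiesAt ν Tp Tm (ρp t) (ρm t) (V t) dρp dρm

/-- `‖ρ - ρ_ss‖² = ‖ρ⁺ - ρ_ss⁺‖² + ‖ρ⁻ - ρ_ss⁻‖²` in `L²`. -/
def distSq {L₁ L₂ : ℝ} (ρp ρm : L2Cyl L₁ L₂) : ℝ :=
  ‖ρp - rhoSSPlus L₁ L₂‖ ^ 2 + ‖ρm - rhoSSMinus L₁ L₂‖ ^ 2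

/-- `ρ_ss` (with zero potential) is a steady state, it is Lyapunov stable in `L²`, and it attracts
every global solution in `L²`. -/
structure GloballyAsymptoticallyStable (L₁ L₂ ν Tp Tm : ℝ) : Prop where
  steady : IsSolution (L₁ := L₁) (L₂ := L₂) ν Tp Tm ⊤
    (fun _ => rhoSSPlus L₁ L₂) (fun _ => rhoSSMinus L₁ L₂) (fun _ => 0)
  stable : ∀ ε : ℝ, 0 < ε → ∃ δ : ℝ, 0 < δ ∧ ∀ (T : EReal) (ρp ρm V : ℝ → L2Cyl L₁ L₂),
    IsSolution ν Tp Tm T ρp ρm V → distSq (ρp 0) (ρm 0) < δ →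
      ∀ t : ℝ, 0 ≤ t → (t : EReal) < T → distSq (ρp t) (ρm t) < ε
  attractive : ∀ ρp ρm V : ℝ → L2Cyl L₁ L₂, IsSolution ν Tp Tm ⊤ ρp ρm V →
    Tendsto (fun t => distSq (ρp t) (ρm t)) atTop (𝓝 0)

end TwoFluid

end

noncomputable section

namespace TwoFluid

open scoped RealInnerProductSpace

variable {L₁ L₂ : ℝ}

/-! Let f, g be the perturbations of the two densities, σ = f + g, μ = (π/L₁)², and let V solve -∇²V
= σ, so that ‖∇V‖² = ⟪V, σ⟫. The Lyapunov functional is W = (‖f‖² + ‖g‖²)/2 - c‖∇V‖² with c =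
1/(L₁ΔT).

The E × B transport term is a Jacobian bracket of V with the density, hence orthogonal to both the
perturbation and V (`inner_bracket_eq_zero`). By translation invariance ∂₂V is orthogonal to ∇²V
(`inner_snd_laplacian_eq_zero`), so ⟪E₂, g⟫ = -⟪E₂, f⟫. The only non-viscous terms left in the
derivative of W are (2/L₁)⟪E₂, f⟫ from the L² norms and -2cΔT⟪E₂, f⟫ from the field energy, and the
choice of c makes them cancel. What remains is ν(2c‖σ‖² - ‖∇f‖² - ‖∇g‖²).

This is at most -2μνW as soon as 4c ≤ μ (`SatisfiesAt.dissipation`): split into f + g and f - g, use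
the Poincaré inequality with constant μ on the difference and ‖∇σ - μ∇V‖² ≥ 0 on the sum. The strict
inequality 4c < μ, which is exactly the hypothesis on ΔT, also makes W comparable to the squared
distance (`IsWeakPotential.functional_bounds`). Grönwall's argument then gives the decay
(`IsSolution.decay`), from which stability and attraction follow.

Most of the remaining work justifies these integrations by parts at the available regularity. -/

instance isFiniteMeasure_cylMeasure (L₁ L₂ : ℝ) : IsFiniteMeasure (cylMeasure L₁ L₂) := by
  have hK : IsCompact (Icc (0 : ℝ) L₁ ×ˢ Icc (0 : ℝ) L₂) := isCompact_Icc.prod isCompact_Icc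
  refine isFiniteMeasure_restrict.2 (ne_of_lt ?_)
  exact (measure_mono (Set.prod_mono Ioo_subset_Icc_self Ioo_subset_Icc_self)).trans_lt
    hK.measure_lt_top

/-! ### Integration of continuous functions over the cylinder -/

lemma integrable_of_continuous {F : ℝ × ℝ → ℝ} (hF : Continuous F) :
    Integrable F (cylMeasure L₁ L₂) :=
  (memLp_of_continuous L₁ L₂ hF).integrable (by norm_num)

lemma integral_cyl_eq (h₁ : 0 < L₁) (h₂ : 0 < L₂) {F : ℝ × ℝ → ℝ} (hF : Continuous F) :
    ∫ p, F p ∂(cylMeasure L₁ L₂) = ∫ x in 0..L₁, ∫ y in 0..L₂, F (x, y) := by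
  have := setIntegral_prod (μ := (volume : Measure ℝ)) (ν := (volume : Measure ℝ)) F
    (s := Ioo 0 L₁) (t := Ioo 0 L₂) (integrable_of_continuous hF)
  rw [intervalIntegral.integral_of_le h₁.le, integral_Ioc_eq_integral_Ioo]
  simp_rw [intervalIntegral.integral_of_le h₂.le, integral_Ioc_eq_integral_Ioo]
  exact this

lemma integral_cyl_eq_swap (h₁ : 0 < L₁) (h₂ : 0 < L₂) {F : ℝ × ℝ → ℝ} (hF : Continuous F) :
    ∫ p, F p ∂(cylMeasure L₁ L₂) = ∫ y in 0..L₂, ∫ x in 0..L₁, F (x, y) := by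
  have e := setIntegral_prod_swap (μ := (volume : Measure ℝ)) (ν := (volume : Measure ℝ))
    (Ioo 0 L₁) (Ioo 0 L₂) F
  have := integral_cyl_eq (L₁ := L₂) (L₂ := L₁) h₂ h₁ (F := fun p => F p.swap)
    (hF.comp continuous_swap)
  exact e.symm.trans this

/-! ### Test functions -/

namespace IsTest

variable {φ ψ : ℝ × ℝ → ℝ}

lemma continuous (h : IsTest L₁ L₂ φ) : Continuous φ := h.smooth.continuous

lemma differentiable (h : IsTest L₁ L₂ φ) : Differentiable ℝ φ :=
  h.smooth.differentiable (by simp)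

lemma zero (h₁ : 0 < L₁) : IsTest L₁ L₂ (fun _ => 0) :=
  ⟨contDiff_const, fun _ _ => rfl, L₁ / 2, L₁ / 2, by linarith, by linarith, by simp⟩

lemma add (h : IsTest L₁ L₂ φ) (k : IsTest L₁ L₂ ψ) : IsTest L₁ L₂ (fun p => φ p + ψ p) := by
  obtain ⟨a, b, ha, hb, hs⟩ := h.support
  obtain ⟨a', b', ha', hb', hs'⟩ := k.support
  refine ⟨h.smooth.add k.smooth, fun x y => by simp [h.periodic, k.periodic],
    min a a', max b b', by simp [ha, ha'], by simp [hb, hb'], fun x y hne => ?_⟩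
  by_cases h0 : φ (x, y) = 0
  · have : ψ (x, y) ≠ 0 := by simpa [h0] using hne
    exact Icc_subset_Icc (min_le_right _ _) (le_max_right _ _) (hs' x y this)
  · exact Icc_subset_Icc (min_le_left _ _) (le_max_left _ _) (hs x y h0)

lemma mul_left {u : ℝ × ℝ → ℝ} (hu : ContDiff ℝ ∞ u) (hp : ∀ x y, u (x, y + L₂) = u (x, y))
    (h : IsTest L₁ L₂ φ) : IsTest L₁ L₂ (fun p => u p * φ p) := by
  obtain ⟨a, b, ha, hb, hs⟩ := h.support
  exact ⟨hu.mul h.smooth, fun x y => by simp [hp, h.periodic], a, b, ha, hb,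
    fun x y hne => hs x y (right_ne_zero_of_mul hne)⟩

lemma const_mul (c : ℝ) (h : IsTest L₁ L₂ φ) : IsTest L₁ L₂ (fun p => c * φ p) :=
  mul_left (u := fun _ => c) contDiff_const (fun _ _ => rfl) h

lemma comp {H : ℝ → ℝ} (hH : ContDiff ℝ ∞ H) (h0 : H 0 = 0) (h : IsTest L₁ L₂ φ) :
    IsTest L₁ L₂ (fun p => H (φ p)) := by
  obtain ⟨a, b, ha, hb, hs⟩ := h.support
  exact ⟨hH.comp h.smooth, fun x y => by simp [h.periodic], a, b, ha, hb,
    fun x y hne => hs x y fun h1 => hne (by simp [h1, h0])⟩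

lemma translate (s : ℝ) (h : IsTest L₁ L₂ φ) : IsTest L₁ L₂ (fun p => φ (p.1, p.2 + s)) := by
  obtain ⟨a, b, ha, hb, hs⟩ := h.support
  refine ⟨h.smooth.comp (by fun_prop), fun x y => ?_, a, b, ha, hb, fun x y => hs x _⟩
  simpa [add_right_comm] using h.periodic x (y + s)

lemma fderiv_apply (h : IsTest L₁ L₂ φ) (e : ℝ × ℝ) :
    IsTest L₁ L₂ (fun p => fderiv ℝ φ p e) := by
  obtain ⟨a, b, ha, hb, hs⟩ := h.support
  refine ⟨(h.smooth.fderiv_right (m := ∞) (by simp)).clm_apply contDiff_const, fun x y => ?_,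
    a, b, ha, hb, fun x y hne => ?_⟩
  · have e1 : (fun p : ℝ × ℝ => φ (p + (0, L₂))) = φ := by
      funext p
      have := h.periodic p.1 p.2
      change φ (p.1 + 0, p.2 + L₂) = φ p
      rwa [add_zero]
    have := fderiv_comp_add_right (𝕜 := ℝ) (f := φ) (x := (x, y)) ((0 : ℝ), L₂)
    rw [e1] at this
    simp [this]
  · have h1 : (x, y) ∈ tsupport φ :=
      support_fderiv_subset ℝ (fun h0 => hne (by simp [h0]))
    have h2 : tsupport φ ⊆ Prod.fst ⁻¹' Icc a b :=
      closure_minimal (fun p hp => hs p.1 p.2 hp) (isClosed_Icc.preimage continuous_fst)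
    exact h2 h1

lemma hasDerivAt_fst (h : IsTest L₁ L₂ φ) (x y : ℝ) :
    HasDerivAt (fun s => φ (s, y)) (fderiv ℝ φ (x, y) e₁) x := by
  have h1 : HasDerivAt (fun s : ℝ => (s, y)) e₁ x :=
    (hasDerivAt_id x).prodMk (hasDerivAt_const x y)
  exact (h.differentiable (x, y)).hasFDerivAt.comp_hasDerivAt x h1

lemma hasDerivAt_snd (h : IsTest L₁ L₂ φ) (x y : ℝ) :
    HasDerivAt (fun s => φ (x, s)) (fderiv ℝ φ (x, y) e₂) y := by
  have h1 : HasDerivAt (fun s : ℝ => (x, s)) e₂ y :=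
    (hasDerivAt_const y x).prodMk (hasDerivAt_id y)
  exact (h.differentiable (x, y)).hasFDerivAt.comp_hasDerivAt y h1

lemma eq_zero_left (h : IsTest L₁ L₂ φ) (y : ℝ) : φ (0, y) = 0 := by
  obtain ⟨a, b, ha, hb, hs⟩ := h.support
  by_contra hne
  exact absurd (hs 0 y hne).1 (not_le.2 ha)

lemma eq_zero_right (h : IsTest L₁ L₂ φ) (y : ℝ) : φ (L₁, y) = 0 := by
  obtain ⟨a, b, ha, hb, hs⟩ := h.support
  by_contra hne
  exact absurd (hs L₁ y hne).2 (not_le.2 hb)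

lemma integral_fderiv_fst (h₁ : 0 < L₁) (h₂ : 0 < L₂) (h : IsTest L₁ L₂ φ) :
    ∫ p, fderiv ℝ φ p e₁ ∂(cylMeasure L₁ L₂) = 0 := by
  have hc := (h.fderiv_apply e₁).continuous
  rw [integral_cyl_eq_swap h₁ h₂ hc]
  have : ∀ y, ∫ x in 0..L₁, fderiv ℝ φ (x, y) e₁ = 0 := fun y => by
    rw [intervalIntegral.integral_eq_sub_of_hasDerivAt (fun x _ => h.hasDerivAt_fst x y)
      ((hc.comp (by fun_prop : Continuous fun x : ℝ => (x, y))).intervalIntegrable _ _)]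
    simp [h.eq_zero_left, h.eq_zero_right]
  simp [this]

lemma integral_fderiv_snd (h₁ : 0 < L₁) (h₂ : 0 < L₂) (h : IsTest L₁ L₂ φ) :
    ∫ p, fderiv ℝ φ p e₂ ∂(cylMeasure L₁ L₂) = 0 := by
  have hc := (h.fderiv_apply e₂).continuous
  rw [integral_cyl_eq h₁ h₂ hc]
  have : ∀ x, ∫ y in 0..L₂, fderiv ℝ φ (x, y) e₂ = 0 := fun x => by
    rw [intervalIntegral.integral_eq_sub_of_hasDerivAt (fun y _ => h.hasDerivAt_snd x y)
      ((hc.comp (by fun_prop : Continuous fun y : ℝ => (x, y))).intervalIntegrable _ _)]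
    have := h.periodic x 0
    simp only [zero_add] at this
    simp [this]
  simp [this]

lemma fderiv_fderiv_comm (h : IsTest L₁ L₂ φ) (p e e' : ℝ × ℝ) :
    fderiv ℝ (fun q => fderiv ℝ φ q e) p e' = fderiv ℝ (fun q => fderiv ℝ φ q e') p e := by
  have hd : DifferentiableAt ℝ (fderiv ℝ φ) p :=
    (h.smooth.fderiv_right (m := ∞) (by simp)).differentiable (by simp) p
  have hs : IsSymmSndFDerivAt ℝ φ p := h.smooth.contDiffAt.isSymmSndFDerivAt (by
    rw [minSmoothness_of_isRCLikeNormedField]; exact WithTop.coe_le_coe.2 (le_top : (2 : ℕ∞) ≤ ⊤))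
  rw [fderiv_clm_apply hd (by fun_prop), fderiv_clm_apply hd (by fun_prop)]
  simpa using hs e' e

end IsTest

/-- A continuous function which is periodic in the second variable has the same integral over the
cylinder as its translates in that variable. -/
lemma integral_translate (h₁ : 0 < L₁) (h₂ : 0 < L₂) {F : ℝ × ℝ → ℝ} (hF : Continuous F)
    (hp : ∀ x y, F (x, y + L₂) = F (x, y)) (s : ℝ) :
    ∫ p, F (p.1, p.2 + s) ∂(cylMeasure L₁ L₂) = ∫ p, F p ∂(cylMeasure L₁ L₂) := by
  rw [integral_cyl_eq h₁ h₂ hF, integral_cyl_eq h₁ h₂ (by fun_prop)]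
  congr 1 with x
  have hper : Function.Periodic (fun y => F (x, y)) L₂ := fun y => hp x y
  have := hper.intervalIntegral_add_eq s 0
  rw [intervalIntegral.integral_comp_add_right (fun y => F (x, y)) s]
  simpa [add_comm] using this

/-- The periodic extension of a smooth function with compact support in the open fundamental
rectangle is a test function. -/
lemma exists_isTest_eqOn (h₂ : 0 < L₂) {g : ℝ × ℝ → ℝ} (hg : ContDiff ℝ ∞ g)
    (hc : HasCompactSupport g) (h₁ : 0 < L₁) (hs : tsupport g ⊆ Ioo 0 L₁ ×ˢ Ioo 0 L₂) :
    ∃ φ, IsTest L₁ L₂ φ ∧ EqOn φ g (Ioo 0 L₁ ×ˢ Ioo 0 L₂) := by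
  have hzero : ∀ x y, g (x, y) ≠ 0 → x ∈ Ioo 0 L₁ ∧ y ∈ Ioo 0 L₂ := fun x y hne =>
    hs (subset_tsupport _ hne)
  refine ⟨fun p => g (p.1, toIcoMod h₂ 0 p.2), ⟨?_, fun x y => ?_, ?_⟩, ?_⟩
  · rw [contDiff_iff_contDiffAt]
    rintro ⟨x₀, y₀⟩
    set k : ℝ := (toIcoDiv h₂ 0 y₀ : ℝ) * L₂ with hk
    have hy₀ : y₀ - k ∈ Ico 0 L₂ := by
      have := toIcoMod_mem_Ico h₂ 0 y₀
      rwa [toIcoMod, zero_add, zsmul_eq_mul, ← hk] at this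
    -- On the strip |x₂ - k| < L₂ the extension is the sum of two translates of g, at most one of
    -- which is nonzero at any point; this handles the seam x₂ = k like any other point.
    have hsm : ContDiffAt ℝ ∞ (fun p : ℝ × ℝ => g (p.1, p.2 - k) + g (p.1, p.2 - k + L₂))
        (x₀, y₀) :=
      ContDiff.contDiffAt ((hg.comp (by fun_prop)).add (hg.comp (by fun_prop)))
    refine hsm.congr_of_eventuallyEq ?_
    have hopen : {p : ℝ × ℝ | p.2 - k ∈ Ioo (-L₂) L₂} ∈ 𝓝 (x₀, y₀) :=
      (isOpen_Ioo.preimage (by fun_prop : Continuous fun p : ℝ × ℝ => p.2 - k)).mem_nhds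
        ⟨by simp only; linarith [hy₀.1], hy₀.2⟩
    filter_upwards [hopen] with p hp
    have hp : p.2 - k ∈ Ioo (-L₂) L₂ := hp
    have hmod : toIcoMod h₂ 0 p.2 = toIcoMod h₂ 0 (p.2 - k) := by
      rw [hk, ← zsmul_eq_mul, toIcoMod_sub_zsmul]
    rcases le_or_gt 0 (p.2 - k) with h0 | h0
    · have e1 : toIcoMod h₂ 0 (p.2 - k) = p.2 - k := by
        rw [toIcoMod_eq_self, zero_add]; exact ⟨h0, hp.2⟩
      have e2 : g (p.1, p.2 - k + L₂) = 0 := by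
        by_contra hne
        linarith [(hzero _ _ hne).2.2]
      simp only [hmod, e1, e2, add_zero]
    · have e1 : toIcoMod h₂ 0 (p.2 - k) = p.2 - k + L₂ := by
        rw [← toIcoMod_add_right, toIcoMod_eq_self]
        exact ⟨by linarith [hp.1], by linarith⟩
      have e2 : g (p.1, p.2 - k) = 0 := by
        by_contra hne
        linarith [(hzero _ _ hne).2.1]
      simp only [hmod, e1, e2, zero_add]
  · simp
  · rcases (tsupport g).eq_empty_or_nonempty with he | hne
    · refine ⟨L₁ / 2, L₁ / 2, by linarith, by linarith, fun x y hxy => ?_⟩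
      have := subset_tsupport g hxy
      simp [he] at this
    · have hK : IsCompact (Prod.fst '' tsupport g) := hc.isCompact.image continuous_fst
      obtain ⟨a, ⟨p, hp, rfl⟩, hla⟩ := hK.exists_isLeast (hne.image _)
      obtain ⟨b, ⟨q, hq, rfl⟩, hub⟩ := hK.exists_isGreatest (hne.image _)
      refine ⟨p.1, q.1, (hs hp).1.1, (hs hq).1.2, fun x y hxy => ?_⟩
      have : x ∈ Prod.fst '' tsupport g := ⟨_, subset_tsupport g hxy, rfl⟩
      exact ⟨hla this, hub this⟩
  · rintro ⟨x, y⟩ ⟨-, hy⟩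
    have : toIcoMod h₂ 0 y = y := by
      rw [toIcoMod_eq_self]; simpa using ⟨hy.1.le, hy.2⟩
    simp only [this]

/-! ### The `L²` theory of weak derivatives -/

lemma inner_eq_integral (f g : L2Cyl L₁ L₂) :
    ⟪f, g⟫ = ∫ p, f p * g p ∂(cylMeasure L₁ L₂) := by
  simp [L2.inner_def, mul_comm]

lemma inner_eq_integral_of_ae {f g : L2Cyl L₁ L₂} {u v : ℝ × ℝ → ℝ}
    (hf : f =ᵐ[cylMeasure L₁ L₂] u) (hg : g =ᵐ[cylMeasure L₁ L₂] v) :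
    ⟪f, g⟫ = ∫ p, u p * v p ∂(cylMeasure L₁ L₂) := by
  rw [inner_eq_integral]
  refine integral_congr_ae ?_
  filter_upwards [hf, hg] with p h1 h2
  rw [h1, h2]

/-- The class in `L²` of a test function. -/
def IsTest.toL2 {φ : ℝ × ℝ → ℝ} (h : IsTest L₁ L₂ φ) : L2Cyl L₁ L₂ :=
  (memLp_of_continuous L₁ L₂ h.continuous).toLp φ

lemma IsTest.coeFn_toL2 {φ : ℝ × ℝ → ℝ} (h : IsTest L₁ L₂ φ) :
    h.toL2 =ᵐ[cylMeasure L₁ L₂] φ :=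
  MemLp.coeFn_toLp _

lemma IsTest.inner_toL2 {φ : ℝ × ℝ → ℝ} (h : IsTest L₁ L₂ φ) (f : L2Cyl L₁ L₂) :
    ⟪f, h.toL2⟫ = ∫ p, f p * φ p ∂(cylMeasure L₁ L₂) :=
  inner_eq_integral_of_ae (ae_eq_refl _) h.coeFn_toL2

lemma IsTest.inner_toL2_toL2 {φ ψ : ℝ × ℝ → ℝ} (h : IsTest L₁ L₂ φ) (k : IsTest L₁ L₂ ψ) :
    ⟪h.toL2, k.toL2⟫ = ∫ p, φ p * ψ p ∂(cylMeasure L₁ L₂) :=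
  inner_eq_integral_of_ae h.coeFn_toL2 k.coeFn_toL2

/-- As an adjointness relation between vectors of L², the definition passes to limits by continuity
of the inner product. -/
lemma hasWeakPartial_iff {e : ℝ × ℝ} {f g : L2Cyl L₁ L₂} :
    HasWeakPartial e f g ↔ ∀ φ (h : IsTest L₁ L₂ φ),
      ⟪f, (h.fderiv_apply e).toL2⟫ = -⟪g, h.toL2⟫ := by
  simp only [IsTest.inner_toL2]; rfl

namespace HasWeakPartial

variable {e : ℝ × ℝ} {f g f' g' : L2Cyl L₁ L₂}

lemma sub (hf : HasWeakPartial e f f') (hg : HasWeakPartial e g g') :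
    HasWeakPartial e (f - g) (f' - g') := by
  rw [hasWeakPartial_iff] at *
  intro φ h
  rw [inner_sub_left, inner_sub_left, hf φ h, hg φ h]; ring

lemma zero (e : ℝ × ℝ) : HasWeakPartial e (0 : L2Cyl L₁ L₂) 0 := by
  rw [hasWeakPartial_iff]
  intro φ h
  simp

end HasWeakPartial

/-- An element of `L²` that is orthogonal to all test functions vanishes. -/
lemma eq_zero_of_inner_toL2_eq_zero (h₁ : 0 < L₁) (h₂ : 0 < L₂) {f : L2Cyl L₁ L₂}
    (hf : ∀ φ (h : IsTest L₁ L₂ φ), ⟪f, h.toL2⟫ = 0) : f = 0 := by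
  have hU : IsOpen (Ioo 0 L₁ ×ˢ Ioo 0 L₂ : Set (ℝ × ℝ)) := isOpen_Ioo.prod isOpen_Ioo
  have hint : IntegrableOn f (Ioo 0 L₁ ×ˢ Ioo 0 L₂ : Set (ℝ × ℝ)) volume :=
    (Lp.memLp f).integrable (by norm_num)
  have key := hU.ae_eq_zero_of_integral_contDiff_smul_eq_zero (μ := (volume : Measure (ℝ × ℝ)))
    (f := f) hint.locallyIntegrableOn (fun g hg hc hs => by
      obtain ⟨φ, hφ, heq⟩ := exists_isTest_eqOn h₂ hg hc h₁ hs
      have h0 := hf φ hφ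
      rw [hφ.inner_toL2] at h0
      have e1 : ∫ p, g p • f p = ∫ p in Ioo 0 L₁ ×ˢ Ioo 0 L₂, g p • f p := by
        refine (setIntegral_eq_integral_of_forall_compl_eq_zero fun p hp => ?_).symm
        have : g p = 0 := by
          by_contra hne
          exact hp (hs (subset_tsupport g hne))
        simp [this]
      refine e1.trans (Eq.trans ?_ h0)
      refine setIntegral_congr_fun hU.measurableSet fun p hp => ?_
      simp [heq hp, mul_comm])
  rw [← ae_restrict_iff' hU.measurableSet] at key
  exact (Lp.eq_zero_iff_ae_eq_zero).2 key

lemma HasWeakPartial.unique (h₁ : 0 < L₁) (h₂ : 0 < L₂) {e : ℝ × ℝ} {f g g' : L2Cyl L₁ L₂}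
    (h : HasWeakPartial e f g) (h' : HasWeakPartial e f g') : g = g' := by
  rw [hasWeakPartial_iff] at h h'
  rw [← sub_eq_zero]
  refine eq_zero_of_inner_toL2_eq_zero h₁ h₂ fun φ hφ => ?_
  have := (h φ hφ).symm.trans (h' φ hφ)
  rw [inner_sub_left]; linarith

/-- Test functions are dense in `L²`. -/
lemma exists_seq_isTest_tendsto (h₁ : 0 < L₁) (h₂ : 0 < L₂) (f : L2Cyl L₁ L₂) :
    ∃ (φ : ℕ → ℝ × ℝ → ℝ) (h : ∀ n, IsTest L₁ L₂ (φ n)),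
      Tendsto (fun n => (h n).toL2) atTop (𝓝 f) := by
  let K : Submodule ℝ (L2Cyl L₁ L₂) :=
    { carrier := {u | ∃ φ, ∃ h : IsTest L₁ L₂ φ, h.toL2 = u}
      add_mem' := by
        rintro _ _ ⟨φ, h, rfl⟩ ⟨ψ, k, rfl⟩
        exact ⟨_, h.add k, rfl⟩
      zero_mem' := ⟨_, IsTest.zero h₁, rfl⟩
      smul_mem' := by
        rintro c _ ⟨φ, h, rfl⟩
        exact ⟨_, h.const_mul c, rfl⟩ }
  have hK : K.topologicalClosure = ⊤ := by
    rw [Submodule.topologicalClosure_eq_top_iff, eq_bot_iff]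
    intro f hf
    refine eq_zero_of_inner_toL2_eq_zero h₁ h₂ fun φ h => ?_
    rw [real_inner_comm]
    exact hf _ ⟨φ, h, rfl⟩
  have hf : f ∈ closure (K : Set (L2Cyl L₁ L₂)) := by
    have : f ∈ K.topologicalClosure := hK ▸ Submodule.mem_top
    exact this
  obtain ⟨u, hu, hlim⟩ := mem_closure_iff_seq_limit.1 hf
  choose φ h hφ using hu
  exact ⟨φ, h, by simpa [hφ] using hlim⟩

/-! ### The space `H¹₀` -/

/-- `(f, f₁, f₂)` is a limit in `L²` of test functions with their partial derivatives. -/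
def IsH10Limit (f f₁ f₂ : L2Cyl L₁ L₂) : Prop :=
  ∃ (φ : ℕ → ℝ × ℝ → ℝ) (h : ∀ n, IsTest L₁ L₂ (φ n)),
    Tendsto (fun n => (h n).toL2) atTop (𝓝 f) ∧
    Tendsto (fun n => ((h n).fderiv_apply e₁).toL2) atTop (𝓝 f₁) ∧
    Tendsto (fun n => ((h n).fderiv_apply e₂).toL2) atTop (𝓝 f₂)

lemma tendsto_toL2_iff {φ : ℕ → ℝ × ℝ → ℝ} (h : ∀ n, IsTest L₁ L₂ (φ n)) (f : L2Cyl L₁ L₂) :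
    Tendsto (fun n => (h n).toL2) atTop (𝓝 f) ↔
      Tendsto (fun n => eLpNorm (fun p => φ n p - f p) 2 (cylMeasure L₁ L₂)) atTop (𝓝 0) := by
  have := Lp.tendsto_Lp_iff_tendsto_eLpNorm'' (fi := atTop) (p := 2) φ
    (fun n => memLp_of_continuous L₁ L₂ (h n).continuous) f (Lp.memLp f)
  rw [Lp.toLp_coeFn] at this
  exact this

lemma MemH10.exists_isH10Limit {f : L2Cyl L₁ L₂} (hf : MemH10 f) :
    ∃ f₁ f₂, HasWeakPartial e₁ f f₁ ∧ HasWeakPartial e₂ f f₂ ∧ IsH10Limit f f₁ f₂ := by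
  obtain ⟨f₁, f₂, w₁, w₂, φ, h, t, t₁, t₂⟩ := hf
  exact ⟨f₁, f₂, w₁, w₂, φ, h, (tendsto_toL2_iff h f).2 t,
    (tendsto_toL2_iff (fun n => (h n).fderiv_apply e₁) f₁).2 t₁,
    (tendsto_toL2_iff (fun n => (h n).fderiv_apply e₂) f₂).2 t₂⟩

lemma memH10_zero (h₁ : 0 < L₁) : MemH10 (0 : L2Cyl L₁ L₂) := by
  have hz : (fun p => (0 : ℝ) - (0 : L2Cyl L₁ L₂) p) =ᵐ[cylMeasure L₁ L₂] fun _ => (0 : ℝ) := by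
    filter_upwards [Lp.coeFn_zero ℝ 2 (cylMeasure L₁ L₂)] with p hp
    rw [hp]; simp
  refine ⟨0, 0, .zero _, .zero _, fun _ _ => 0, fun _ => IsTest.zero h₁, ?_, ?_, ?_⟩ <;>
  · simp only [fderiv_fun_const, Pi.zero_apply, zero_apply, eLpNorm_congr_ae hz]
    simp

namespace IsH10Limit

variable {a a' b b₁ b₂ c c₁ c₂ : L2Cyl L₁ L₂}

lemma add_smul (hb : IsH10Limit b b₁ b₂) (r : ℝ) (hc : IsH10Limit c c₁ c₂) :
    IsH10Limit (b + r • c) (b₁ + r • c₁) (b₂ + r • c₂) := by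
  obtain ⟨φ, h, t, t₁, t₂⟩ := hb
  obtain ⟨ψ, k, s, s₁, s₂⟩ := hc
  have hd : ∀ e : ℝ × ℝ, ∀ n, (((h n).add ((k n).const_mul r)).fderiv_apply e).toL2 =
      ((h n).fderiv_apply e).toL2 + r • ((k n).fderiv_apply e).toL2 := fun e n => by
    refine Lp.ext ?_
    filter_upwards [(((h n).add ((k n).const_mul r)).fderiv_apply e).coeFn_toL2,
      Lp.coeFn_add ((h n).fderiv_apply e).toL2 (r • ((k n).fderiv_apply e).toL2),
      Lp.coeFn_smul r ((k n).fderiv_apply e).toL2,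
      ((h n).fderiv_apply e).coeFn_toL2, ((k n).fderiv_apply e).coeFn_toL2] with p e1 e2 e3 e4 e5
    rw [e1, e2, Pi.add_apply, e3, Pi.smul_apply, e4, e5,
      fderiv_fun_add ((h n).differentiable p) (((k n).const_mul r).differentiable p),
      fderiv_const_mul ((k n).differentiable p)]
    rfl
  refine ⟨_, fun n => (h n).add ((k n).const_mul r), t.add (s.const_smul r), ?_, ?_⟩
  · simpa only [hd] using t₁.add (s₁.const_smul r)
  · simpa only [hd] using t₂.add (s₂.const_smul r)

/-- Integration by parts without boundary term: only b has to vanish on the boundary, while a needs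
nothing beyond its weak derivative. -/
lemma inner_fst (hb : IsH10Limit b b₁ b₂) (ha : HasWeakPartial e₁ a a') :
    ⟪a, b₁⟫ = -⟪a', b⟫ := by
  obtain ⟨φ, h, t, t₁, t₂⟩ := hb
  rw [hasWeakPartial_iff] at ha
  refine tendsto_nhds_unique ((tendsto_const_nhds (x := a)).inner t₁) ?_
  simp only [ha _ (h _)]
  exact ((tendsto_const_nhds (x := a')).inner t).neg

lemma inner_snd (hb : IsH10Limit b b₁ b₂) (ha : HasWeakPartial e₂ a a') :
    ⟪a, b₂⟫ = -⟪a', b⟫ := by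
  obtain ⟨φ, h, t, t₁, t₂⟩ := hb
  rw [hasWeakPartial_iff] at ha
  refine tendsto_nhds_unique ((tendsto_const_nhds (x := a)).inner t₂) ?_
  simp only [ha _ (h _)]
  exact ((tendsto_const_nhds (x := a')).inner t).neg

end IsH10Limit

/-! ### The Poincaré inequality -/

/-- Wirtinger's inequality on `[0, L]` for functions vanishing near the end points. -/
lemma integral_deriv_sq_sub_nonneg {L a b : ℝ} (hL : 0 < L) {f f' : ℝ → ℝ}
    (hf : ∀ x, HasDerivAt f (f' x) x) (hf' : Continuous f') (ha : 0 < a) (hb : b < L)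
    (hs : ∀ x, f x ≠ 0 → x ∈ Icc a b) :
    0 ≤ ∫ x in 0..L, (f' x ^ 2 - (Real.pi / L) ^ 2 * f x ^ 2) := by
  set k := Real.pi / L with hk
  have hkpos : 0 < k := div_pos Real.pi_pos hL
  have hfc : Continuous f := continuous_iff_continuousAt.2 fun x => (hf x).continuousAt
  -- Picone's identity with the ground state sin(kx): f'² - k²f² - G' = (f' - k cot(kx) f)². The
  -- poles of the cotangent at 0 and L are harmless because f vanishes near them.
  set G : ℝ → ℝ := fun x => k * (Real.cos (k * x) / Real.sin (k * x)) * f x ^ 2 with hG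
  have hsin : ∀ x ∈ Ioo 0 L, 0 < Real.sin (k * x) := fun x hx => by
    refine Real.sin_pos_of_pos_of_lt_pi (mul_pos hkpos hx.1) ?_
    calc k * x < k * L := by gcongr; exact hx.2
      _ = Real.pi := by rw [hk]; field_simp
  have hder : ∀ x ∈ Ioo 0 L, HasDerivAt G
      (k * ((-Real.sin (k * x) * k * Real.sin (k * x) - Real.cos (k * x) * (Real.cos (k * x) * k))
        / Real.sin (k * x) ^ 2) * f x ^ 2 +
        k * (Real.cos (k * x) / Real.sin (k * x)) * (2 * f x * f' x)) x := fun x hx => by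
    have h0 : HasDerivAt (fun x => k * x) k x := by simpa using (hasDerivAt_id x).const_mul k
    have h1 := ((h0.cos.div h0.sin (hsin x hx).ne').const_mul k).mul ((hf x).pow 2)
    refine HasDerivAt.congr_deriv (f := G) h1 ?_
    simp
  have hout : ∀ x, x ∉ Icc a b → G =ᶠ[𝓝 x] fun _ => 0 := fun x hx => by
    filter_upwards [isClosed_Icc.isOpen_compl.mem_nhds hx] with y hy
    have : f y = 0 := by
      by_contra h
      exact hy (hs y h)
    simp [hG, this]
  have hcont : ContinuousOn G (Icc 0 L) := fun x hx => by
    refine ContinuousAt.continuousWithinAt ?_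
    by_cases hx' : x ∈ Icc a b
    · exact (hder x ⟨ha.trans_le hx'.1, hx'.2.trans_lt hb⟩).continuousAt
    · exact (continuousAt_const).congr (hout x hx').symm
  have hint : Continuous fun x => f' x ^ 2 - k ^ 2 * f x ^ 2 := by fun_prop
  have key := intervalIntegral.sub_le_integral_of_hasDeriv_right_of_le hL.le hcont
    (fun x hx => (hder x hx).hasDerivWithinAt)
    (hint.continuousOn.integrableOn_Icc) (fun x hx => ?_)
  · have e0 : G 0 = 0 := (hout 0 fun h => absurd h.1 (not_le.2 ha)).eq_of_nhds
    have e1 : G L = 0 := (hout L fun h => absurd h.2 (not_le.2 hb)).eq_of_nhds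
    rwa [e0, e1, sub_zero] at key
  · have hS := hsin x hx
    set S := Real.sin (k * x)
    set C := Real.cos (k * x)
    have e : f' x ^ 2 - k ^ 2 * f x ^ 2 -
        (k * ((-S * k * S - C * (C * k)) / S ^ 2) * f x ^ 2 + k * (C / S) * (2 * f x * f' x)) =
        (f' x - k * (C / S) * f x) ^ 2 := by
      field_simp
      ring
    nlinarith [sq_nonneg (f' x - k * (C / S) * f x)]

lemma IsTest.poincare (h₁ : 0 < L₁) (h₂ : 0 < L₂) {φ : ℝ × ℝ → ℝ} (h : IsTest L₁ L₂ φ) :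
    (Real.pi / L₁) ^ 2 * ‖h.toL2‖ ^ 2 ≤ ‖(h.fderiv_apply e₁).toL2‖ ^ 2 := by
  obtain ⟨a, b, ha, hb, hs⟩ := h.support
  have hc := h.continuous
  have hc' := (h.fderiv_apply e₁).continuous
  rw [← real_inner_self_eq_norm_sq, ← real_inner_self_eq_norm_sq, IsTest.inner_toL2_toL2,
    IsTest.inner_toL2_toL2, ← integral_const_mul, ← sub_nonneg,
    ← integral_sub (integrable_of_continuous (by fun_prop)) (integrable_of_continuous (by fun_prop)),
    integral_cyl_eq_swap h₁ h₂ (by fun_prop)]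
  refine intervalIntegral.integral_nonneg h₂.le fun y _ => ?_
  have := integral_deriv_sq_sub_nonneg h₁ (fun x => h.hasDerivAt_fst x y)
    (hc'.comp (by fun_prop : Continuous fun x : ℝ => (x, y))) ha hb (fun x => hs x y)
  simpa only [pow_two (fderiv ℝ φ _ _), pow_two (φ _)] using this

lemma IsH10Limit.poincare (h₁ : 0 < L₁) (h₂ : 0 < L₂) {b b₁ b₂ : L2Cyl L₁ L₂}
    (hb : IsH10Limit b b₁ b₂) : (Real.pi / L₁) ^ 2 * ‖b‖ ^ 2 ≤ ‖b₁‖ ^ 2 := by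
  obtain ⟨φ, h, t, t₁, -⟩ := hb
  exact le_of_tendsto_of_tendsto' ((t.norm.pow 2).const_mul _) (t₁.norm.pow 2)
    fun n => (h n).poincare h₁ h₂

/-! ### The transport term -/

lemma integrable_mul_L2 (u v : L2Cyl L₁ L₂) :
    Integrable (fun p => u p * v p) (cylMeasure L₁ L₂) :=
  (Lp.memLp u).integrable_mul (Lp.memLp v)

lemma integral_abs_mul_abs_le (u v : L2Cyl L₁ L₂) :
    ∫ p, |u p| * |v p| ∂(cylMeasure L₁ L₂) ≤ ‖u‖ * ‖v‖ := by
  rw [← inner_eq_integral_of_ae (Lp.coeFn_abs u) (Lp.coeFn_abs v)]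
  have := real_inner_le_norm |u| |v|
  rwa [norm_abs_eq_norm, norm_abs_eq_norm] at this

/-- The limit with v held fixed is dominated convergence; the error from replacing v is at most
M‖u‖‖vs n - v‖ by Cauchy–Schwarz. -/
lemma tendsto_integral_mul_mul (u v : L2Cyl L₁ L₂) {vs : ℕ → L2Cyl L₁ L₂}
    (hv : Tendsto vs atTop (𝓝 v)) {ws : ℕ → ℝ × ℝ → ℝ} {w : ℝ × ℝ → ℝ} {M : ℝ}
    (hmeas : ∀ n, AEStronglyMeasurable (ws n) (cylMeasure L₁ L₂))
    (hM : ∀ n p, |ws n p| ≤ M)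
    (hw : ∀ᵐ p ∂(cylMeasure L₁ L₂), Tendsto (fun n => ws n p) atTop (𝓝 (w p))) :
    Tendsto (fun n => ∫ p, u p * vs n p * ws n p ∂(cylMeasure L₁ L₂)) atTop
      (𝓝 (∫ p, u p * v p * w p ∂(cylMeasure L₁ L₂))) := by
  have hM0 : 0 ≤ M := (abs_nonneg _).trans (hM 0 0)
  have hint : ∀ (z : L2Cyl L₁ L₂) n,
      Integrable (fun p => u p * z p * ws n p) (cylMeasure L₁ L₂) := fun z n =>
    (integrable_mul_L2 u z).mul_bdd (hmeas n) (c := M) (Eventually.of_forall fun p => hM n p)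
  have t1 : Tendsto (fun n => ∫ p, u p * v p * ws n p ∂(cylMeasure L₁ L₂)) atTop
      (𝓝 (∫ p, u p * v p * w p ∂(cylMeasure L₁ L₂))) := by
    refine tendsto_integral_of_dominated_convergence (fun p => |u p * v p| * M)
      (fun n => (hint v n).aestronglyMeasurable) ((integrable_mul_L2 u v).abs.mul_const M)
      (fun n => Eventually.of_forall fun p => ?_) ?_
    · rw [norm_mul]
      exact mul_le_mul_of_nonneg_left (hM n p) (norm_nonneg _)
    · filter_upwards [hw] with p hp using hp.const_mul _
  have t2 : Tendsto (fun n => ∫ p, u p * (vs n - v) p * ws n p ∂(cylMeasure L₁ L₂)) atTop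
      (𝓝 0) := by
    have hb : ∀ n, |∫ p, u p * (vs n - v) p * ws n p ∂(cylMeasure L₁ L₂)| ≤
        ‖u‖ * ‖vs n - v‖ * M := fun n => by
      have e1 : |∫ p, u p * (vs n - v) p * ws n p ∂(cylMeasure L₁ L₂)| ≤
          ∫ p, |u p| * |(vs n - v) p| * M ∂(cylMeasure L₁ L₂) := by
        refine (abs_integral_le_integral_abs).trans (integral_mono (hint _ n).abs ?_ fun p => ?_)
        · simpa only [abs_mul] using (integrable_mul_L2 u (vs n - v)).abs.mul_const M
        · simp only [abs_mul]
          exact mul_le_mul_of_nonneg_left (hM n p) (by positivity)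
      rw [integral_mul_const] at e1
      exact e1.trans (mul_le_mul_of_nonneg_right (integral_abs_mul_abs_le _ _) hM0)
    refine squeeze_zero_norm hb ?_
    have : Tendsto (fun n => ‖vs n - v‖) atTop (𝓝 0) := tendsto_iff_norm_sub_tendsto_zero.1 hv
    simpa using (this.const_mul ‖u‖).mul_const M
  have hsum := t1.add t2
  rw [add_zero] at hsum
  refine hsum.congr fun n => ?_
  rw [← integral_add (hint _ n) (hint _ n)]
  refine integral_congr_ae ?_
  filter_upwards [Lp.coeFn_sub (vs n) v] with p hp
  rw [hp, Pi.sub_apply]; ring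

/-- By the chain rule H'(φ)∇φ = ∇(H(φ)), and H(φ) is again a test function since H(0) = 0. Moving
the derivatives off A leaves its two mixed second partials, which agree. -/
lemma IsTest.integral_bracket_comp {A A₁ A₂ : L2Cyl L₁ L₂} (hA₁ : HasWeakPartial e₁ A A₁)
    (hA₂ : HasWeakPartial e₂ A A₂) {φ : ℝ × ℝ → ℝ} (h : IsTest L₁ L₂ φ) {H H' : ℝ → ℝ}
    (hH : ContDiff ℝ ∞ H) (h0 : H 0 = 0) (hd : ∀ s, HasDerivAt H (H' s) s) :
    ∫ p, A₁ p * (h.fderiv_apply e₂).toL2 p * H' (φ p) ∂(cylMeasure L₁ L₂) =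
      ∫ p, A₂ p * (h.fderiv_apply e₁).toL2 p * H' (φ p) ∂(cylMeasure L₁ L₂) := by
  have hψ := h.comp hH h0
  have hfd : ∀ p e, fderiv ℝ (fun p => H (φ p)) p e = fderiv ℝ φ p e * H' (φ p) := fun p e => by
    have := (hd (φ p)).comp_hasFDerivAt p (h.differentiable p).hasFDerivAt
    have e1 : fderiv ℝ (fun p => H (φ p)) p = H' (φ p) • fderiv ℝ φ p := this.fderiv
    rw [e1]
    simp [mul_comm]
  have conv : ∀ (B : L2Cyl L₁ L₂) e,
      ∫ p, B p * (h.fderiv_apply e).toL2 p * H' (φ p) ∂(cylMeasure L₁ L₂) =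
        ⟪B, (hψ.fderiv_apply e).toL2⟫ := fun B e => by
    rw [IsTest.inner_toL2]
    refine integral_congr_ae ?_
    filter_upwards [(h.fderiv_apply e).coeFn_toL2] with p hp
    rw [hp, hfd]; ring
  rw [hasWeakPartial_iff] at hA₁ hA₂
  have i1 := hA₁ _ (hψ.fderiv_apply e₂)
  have i2 := hA₂ _ (hψ.fderiv_apply e₁)
  have i3 : ⟪A, ((hψ.fderiv_apply e₂).fderiv_apply e₁).toL2⟫ =
      ⟪A, ((hψ.fderiv_apply e₁).fderiv_apply e₂).toL2⟫ := by
    simp only [IsTest.inner_toL2, hψ.fderiv_fderiv_comm _ e₂ e₁]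
  rw [conv, conv]
  linarith

/-- Only boundedness in s for fixed ε matters; the constant is not sharp. -/
lemma abs_div_one_add_le (ε s : ℝ) (hε : 0 < ε) : |s / (1 + ε * s ^ 2)| ≤ 1 + 1 / ε := by
  have hpos : 0 < 1 + ε * s ^ 2 := by positivity
  rw [abs_div, abs_of_pos hpos, div_le_iff₀ hpos]
  have e : (1 + 1 / ε) * (1 + ε * s ^ 2) = 1 + s ^ 2 + (ε * s ^ 2 + 1 / ε) := by
    field_simp; ring
  have : |s| ≤ 1 + s ^ 2 := by nlinarith [sq_abs s, sq_nonneg (|s| - 1), abs_nonneg s]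
  have : 0 ≤ ε * s ^ 2 + 1 / ε := by positivity
  linarith

/-- The bracket `∂₁A ∂₂B - ∂₂A ∂₁B` of `A ∈ H¹` with `B ∈ H¹₀` is orthogonal to `B` as soon as it
is in `L²`. -/
lemma inner_bracket_eq_zero {A A₁ A₂ B B₁ B₂ N : L2Cyl L₁ L₂} (hA₁ : HasWeakPartial e₁ A A₁)
    (hA₂ : HasWeakPartial e₂ A A₂) (hB : IsH10Limit B B₁ B₂)
    (hN : ∀ᵐ p ∂(cylMeasure L₁ L₂), N p = A₁ p * B₂ p - A₂ p * B₁ p) : ⟪N, B⟫ = 0 := by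
  obtain ⟨φ, h, t, t₁, t₂⟩ := hB
  -- The nonlinear factor needs pointwise convergence, hence an almost everywhere convergent
  -- subsequence.
  obtain ⟨ns, hns, hae⟩ := (tendstoInMeasure_of_tendsto_eLpNorm (p := 2) (by norm_num)
    (fun n => (h n).continuous.aestronglyMeasurable) (Lp.aestronglyMeasurable B)
    ((tendsto_toL2_iff h B).1 t)).exists_seq_tendsto_ae
  have trunc : ∀ ε : ℝ, 0 < ε →
      ∫ p, N p * (B p / (1 + ε * B p ^ 2)) ∂(cylMeasure L₁ L₂) = 0 := fun ε hε => by
    have hpos : ∀ s : ℝ, 0 < 1 + ε * s ^ 2 := fun s => by positivity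
    have hcont : Continuous fun s : ℝ => s / (1 + ε * s ^ 2) :=
      continuous_id.div (by fun_prop) fun s => (hpos s).ne'
    -- A smooth replacement for s²/2 whose derivative s/(1 + εs²) is bounded and tends to s as ε →
    -- 0.
    have hH : ContDiff ℝ ∞ fun s : ℝ => Real.log (1 + ε * s ^ 2) / (2 * ε) :=
      (ContDiff.log (by fun_prop) fun s => (hpos s).ne').div_const _
    have hd : ∀ s, HasDerivAt (fun s : ℝ => Real.log (1 + ε * s ^ 2) / (2 * ε))
        (s / (1 + ε * s ^ 2)) s := fun s => by
      have h1 : HasDerivAt (fun s : ℝ => 1 + ε * s ^ 2) (ε * (2 * s)) s := by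
        simpa using ((hasDerivAt_pow 2 s).const_mul ε).const_add 1
      refine ((h1.log (hpos s).ne').div_const (2 * ε)).congr_deriv ?_
      have := (hpos s).ne'
      field_simp
    have hw : ∀ᵐ p ∂(cylMeasure L₁ L₂), Tendsto
        (fun n => φ (ns n) p / (1 + ε * φ (ns n) p ^ 2)) atTop
        (𝓝 (B p / (1 + ε * B p ^ 2))) := by
      filter_upwards [hae] with p hp
      exact (hcont.tendsto (B p)).comp hp
    have lim : ∀ (u v : L2Cyl L₁ L₂) e,
        Tendsto (fun n => ((h n).fderiv_apply e).toL2) atTop (𝓝 v) →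
        Tendsto (fun n => ∫ p, u p * ((h (ns n)).fderiv_apply e).toL2 p *
          (φ (ns n) p / (1 + ε * φ (ns n) p ^ 2)) ∂(cylMeasure L₁ L₂)) atTop
          (𝓝 (∫ p, u p * v p * (B p / (1 + ε * B p ^ 2)) ∂(cylMeasure L₁ L₂))) :=
      fun u v e hv => tendsto_integral_mul_mul u v (hv.comp hns.tendsto_atTop)
        (fun n => (hcont.comp (h (ns n)).continuous).aestronglyMeasurable)
        (fun n p => abs_div_one_add_le ε _ hε) hw
    have heq := tendsto_nhds_unique ((lim A₁ B₂ e₂ t₂).congr fun n =>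
      (h (ns n)).integral_bracket_comp hA₁ hA₂ hH (by simp) hd) (lim A₂ B₁ e₁ t₁)
    have hmeas : AEStronglyMeasurable (fun p => B p / (1 + ε * B p ^ 2)) (cylMeasure L₁ L₂) :=
      hcont.comp_aestronglyMeasurable (Lp.aestronglyMeasurable B)
    have hint : ∀ u v : L2Cyl L₁ L₂, Integrable
        (fun p => u p * v p * (B p / (1 + ε * B p ^ 2))) (cylMeasure L₁ L₂) := fun u v =>
      (integrable_mul_L2 u v).mul_bdd hmeas (c := 1 + 1 / ε)
        (Eventually.of_forall fun p => abs_div_one_add_le ε _ hε)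
    rw [← sub_eq_zero, ← integral_sub (hint _ _) (hint _ _)] at heq
    rw [← heq]
    refine integral_congr_ae ?_
    filter_upwards [hN] with p hp
    rw [hp]; ring
  -- Removing the truncation needs N ∈ L²: the bound |N B| is integrable, whereas A₁B₂B and A₂B₁B
  -- separately need not be.
  have hlim : Tendsto (fun n : ℕ => ∫ p, N p * (B p / (1 + (1 / ((n : ℝ) + 1)) * B p ^ 2))
      ∂(cylMeasure L₁ L₂)) atTop (𝓝 (∫ p, N p * B p ∂(cylMeasure L₁ L₂))) := by
    refine tendsto_integral_of_dominated_convergence (fun p => |N p * B p|) (fun n => ?_)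
      (integrable_mul_L2 N B).abs (fun n => Eventually.of_forall fun p => ?_)
      (Eventually.of_forall fun p => ?_)
    · have hB := (Lp.aestronglyMeasurable B).aemeasurable
      have hN := (Lp.aestronglyMeasurable N).aemeasurable
      exact (hN.mul (hB.div ((hB.pow_const 2).const_mul _ |>.const_add 1))).aestronglyMeasurable
    · rw [Real.norm_eq_abs, abs_mul, abs_mul, abs_div]
      refine mul_le_mul_of_nonneg_left (div_le_self (abs_nonneg _) ?_) (abs_nonneg _)
      refine le_trans ?_ (le_abs_self _)
      have : 0 ≤ 1 / ((n : ℝ) + 1) * B p ^ 2 := by positivity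
      linarith
    · have h1 : Tendsto (fun n : ℕ => 1 + (1 / ((n : ℝ) + 1)) * B p ^ 2) atTop (𝓝 1) := by
        simpa using (tendsto_one_div_add_atTop_nhds_zero_nat.mul_const (B p ^ 2)).const_add 1
      simpa using ((tendsto_const_nhds (x := B p)).div h1 one_ne_zero).const_mul (N p)
  rw [inner_eq_integral]
  refine tendsto_nhds_unique hlim ?_
  simp only [trunc _ (Nat.one_div_pos_of_nat)]
  exact tendsto_const_nhds

/-! ### Skew-symmetry of the derivative in the periodic direction -/

namespace IsTest

variable {φ ψ : ℝ × ℝ → ℝ}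

lemma inner_translate (h₁ : 0 < L₁) (h₂ : 0 < L₂) (h : IsTest L₁ L₂ φ) (k : IsTest L₁ L₂ ψ)
    (s : ℝ) : ⟪(h.translate s).toL2, (k.translate s).toL2⟫ = ⟪h.toL2, k.toL2⟫ := by
  rw [inner_toL2_toL2, inner_toL2_toL2]
  exact integral_translate h₁ h₂ (F := fun p => φ p * ψ p) (h.continuous.mul k.continuous)
    (fun x y => by rw [h.periodic, k.periodic]) s

lemma norm_translate (h₁ : 0 < L₁) (h₂ : 0 < L₂) (h : IsTest L₁ L₂ φ) (s : ℝ) :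
    ‖(h.translate s).toL2‖ = ‖h.toL2‖ := by
  have := h.inner_translate h₁ h₂ h s
  rw [real_inner_self_eq_norm_sq, real_inner_self_eq_norm_sq] at this
  exact (pow_left_inj₀ (norm_nonneg _) (norm_nonneg _) two_ne_zero).1 this

lemma norm_translate_sub (h₁ : 0 < L₁) (h₂ : 0 < L₂) (h : IsTest L₁ L₂ φ) (k : IsTest L₁ L₂ ψ)
    (s : ℝ) : ‖(h.translate s).toL2 - (k.translate s).toL2‖ = ‖h.toL2 - k.toL2‖ := by
  refine (pow_left_inj₀ (norm_nonneg _) (norm_nonneg _) two_ne_zero).1 ?_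
  rw [norm_sub_sq_real, norm_sub_sq_real, h.inner_translate h₁ h₂ k s, h.norm_translate h₁ h₂,
    k.norm_translate h₁ h₂]

lemma fderiv_translate (φ : ℝ × ℝ → ℝ) (s : ℝ) (p e : ℝ × ℝ) :
    fderiv ℝ (fun q : ℝ × ℝ => φ (q.1, q.2 + s)) p e = fderiv ℝ φ (p.1, p.2 + s) e := by
  have e1 : (fun q : ℝ × ℝ => φ (q.1, q.2 + s)) = fun q => φ (q + (0, s)) := by
    funext q
    have : q + (0, s) = (q.1, q.2 + s) := by ext <;> simp
    rw [this]
  have e2 : p + (0, s) = (p.1, p.2 + s) := by ext <;> simp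
  rw [e1, fderiv_comp_add_right, e2]

lemma hasDerivAt_inner_translate (h : IsTest L₁ L₂ φ) (u : L2Cyl L₁ L₂) (s₀ : ℝ) :
    HasDerivAt (fun s => ⟪u, (h.translate s).toL2⟫)
      ⟪u, ((h.translate s₀).fderiv_apply e₂).toL2⟫ s₀ := by
  simp only [inner_toL2, fderiv_translate]
  have hK : IsCompact (Icc (0 : ℝ) L₁ ×ˢ Icc (s₀ - 1) (L₂ + s₀ + 1)) :=
    isCompact_Icc.prod isCompact_Icc
  have hc := h.continuous
  have hc' := (h.fderiv_apply e₂).continuous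
  obtain ⟨M, hM⟩ := hK.exists_bound_of_continuousOn hc'.continuousOn
  have hu := Lp.aestronglyMeasurable u
  have hu1 : Integrable u (cylMeasure L₁ L₂) := (Lp.memLp u).integrable (by norm_num)
  refine (hasDerivAt_integral_of_dominated_loc_of_deriv_le (s := Ioo (s₀ - 1) (s₀ + 1))
    (bound := fun p => |u p| * M)
    (F' := fun s p => u p * fderiv ℝ φ (p.1, p.2 + s) e₂)
    (Ioo_mem_nhds (by linarith) (by linarith))
    (Eventually.of_forall fun s => hu.mul
      (hc.comp (by fun_prop : Continuous fun p : ℝ × ℝ => (p.1, p.2 + s))).aestronglyMeasurable)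
    ?_ (hu.mul (hc'.comp
      (by fun_prop : Continuous fun p : ℝ × ℝ => (p.1, p.2 + s₀))).aestronglyMeasurable)
    ?_ (hu1.abs.mul_const M) (Eventually.of_forall fun p s _ => ?_)).2
  · exact (Lp.memLp u).integrable_mul (memLp_of_continuous L₁ L₂
      (hc.comp (by fun_prop : Continuous fun p : ℝ × ℝ => (p.1, p.2 + s₀))))
  · filter_upwards [ae_restrict_mem (measurableSet_Ioo.prod measurableSet_Ioo)] with p hp s hs
    rw [norm_mul]
    refine mul_le_mul_of_nonneg_left (hM _ ⟨⟨hp.1.1.le, hp.1.2.le⟩, ?_, ?_⟩) (norm_nonneg _)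
    · simp only
      linarith [hp.2.1, hs.1]
    · simp only
      linarith [hp.2.2, hs.2]
  · have h1 := (h.hasDerivAt_snd p.1 (p.2 + s)).comp_const_add p.2 s
    exact h1.const_mul _

end IsTest

/-- The weak derivative in the periodic direction is skew-symmetric. -/
lemma HasWeakPartial.inner_self_eq_zero (h₁ : 0 < L₁) (h₂ : 0 < L₂) {A A' : L2Cyl L₁ L₂}
    (hA : HasWeakPartial e₂ A A') : ⟪A', A⟫ = 0 := by
  obtain ⟨φ, h, t⟩ := exists_seq_isTest_tendsto h₁ h₂ A
  rw [hasWeakPartial_iff] at hA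
  have hder : ∀ n s, HasDerivAt (fun s => ⟪A, ((h n).translate s).toL2⟫)
      (-⟪A', ((h n).translate s).toL2⟫) s := fun n s => by
    rw [← hA]
    exact (h n).hasDerivAt_inner_translate A s
  have hcont : ∀ n, Continuous fun s => ⟪A, ((h n).translate s).toL2⟫ := fun n =>
    continuous_iff_continuousAt.2 fun s => (hder n s).continuousAt
  have htr0 : ∀ n, ((h n).translate 0).toL2 = (h n).toL2 := fun n => by
    simp only [IsTest.toL2, add_zero]
  -- By Cauchy–Schwarz and invariance of the norm under translation, the correlation of A with the
  -- translates of φ n is nearly maximal at shift 0. Its derivative there, close to -⟪A', A⟫, must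
  -- therefore be small. Nothing is assumed about A on the boundary.
  have hgap : Tendsto (fun n => ‖A‖ * ‖(h n).toL2‖ - ⟪A, (h n).toL2⟫) atTop (𝓝 0) := by
    have := (t.norm.const_mul ‖A‖).sub ((tendsto_const_nhds (x := A)).inner t)
    rwa [real_inner_self_eq_norm_mul_norm, sub_self] at this
  have hdist : Tendsto (fun n => ‖(h n).toL2 - A‖) atTop (𝓝 0) :=
    tendsto_iff_norm_sub_tendsto_zero.1 t
  have bound : ∀ ε > 0, |⟪A', A⟫| ≤ ε * (2 + 3 * ‖A'‖) := fun ε hε => by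
    -- The fixed index N supplies a modulus of continuity δ that serves all large n, because
    -- translation is an isometry.
    obtain ⟨N, hN⟩ := ((tendsto_order.1 hdist).2 ε hε).exists
    have hcN : ContinuousAt (fun s => ⟪A', ((h N).translate s).toL2⟫) 0 :=
      ((h N).hasDerivAt_inner_translate A' 0).continuousAt
    obtain ⟨δ, hδ, hδN⟩ := Metric.continuousAt_iff.1 hcN ε hε
    set r := δ / 2 with hr
    have hr0 : 0 < r := by positivity
    -- The index n is chosen after r: the gap must be below ε r, so that the difference quotients
    -- over [0, r] and [-r, 0] bound the derivative by ε from either side.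
    obtain ⟨n, hn1, hn2⟩ := (((tendsto_order.1 hgap).2 (ε * r) (by positivity)).and
      ((tendsto_order.1 hdist).2 ε hε)).exists
    have hle : ∀ s, ⟪A, ((h n).translate s).toL2⟫ ≤ ‖A‖ * ‖(h n).toL2‖ := fun s => by
      have := real_inner_le_norm A ((h n).translate s).toL2
      rwa [(h n).norm_translate h₁ h₂] at this
    have near : ∀ s, |s| < δ → |⟪A', ((h n).translate s).toL2⟫ - ⟪A', A⟫| ≤
        ε * (1 + 3 * ‖A'‖) := fun s hs => by
      have i1 : |⟪A', ((h n).translate s).toL2⟫ - ⟪A', ((h N).translate s).toL2⟫| ≤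
          ‖A'‖ * (2 * ε) := by
        rw [← inner_sub_right]
        refine (abs_real_inner_le_norm _ _).trans (mul_le_mul_of_nonneg_left ?_ (norm_nonneg _))
        rw [(h n).norm_translate_sub h₁ h₂ (h N)]
        have := norm_sub_le_norm_sub_add_norm_sub (h n).toL2 A (h N).toL2
        rw [norm_sub_rev A] at this
        linarith
      have i2 : |⟪A', ((h N).translate s).toL2⟫ - ⟪A', (h N).toL2⟫| ≤ ε := by
        have := hδN (x := s) (by simpa using hs)
        rw [htr0, Real.dist_eq] at this
        exact this.le
      have i3 : |⟪A', (h N).toL2⟫ - ⟪A', A⟫| ≤ ‖A'‖ * ε := by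
        rw [← inner_sub_right]
        exact (abs_real_inner_le_norm _ _).trans
          (mul_le_mul_of_nonneg_left hN.le (norm_nonneg _))
      rw [abs_le] at i1 i2 i3 ⊢
      constructor <;> linarith [i1.1, i1.2, i2.1, i2.2, i3.1, i3.2]
    obtain ⟨s, hs, es⟩ := exists_hasDerivAt_eq_slope _ _ hr0 (hcont n).continuousOn
      (fun x _ => hder n x)
    obtain ⟨s', hs', es'⟩ := exists_hasDerivAt_eq_slope _ _ (neg_lt_zero.2 hr0)
      (hcont n).continuousOn (fun x _ => hder n x)
    have n1 := near s (by rw [abs_of_pos hs.1]; linarith [hs.2])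
    have n2 := near s' (by rw [abs_of_neg hs'.2]; linarith [hs'.1])
    simp only [htr0] at es es'
    rw [eq_div_iff (by linarith)] at es es'
    rw [abs_le] at n1 n2 ⊢
    have l1 : -ε ≤ ⟪A', ((h n).translate s).toL2⟫ := by
      by_contra hlt
      have := hle r
      nlinarith
    have l2 : ⟪A', ((h n).translate s').toL2⟫ ≤ ε := by
      by_contra hlt
      have := hle (-r)
      nlinarith
    constructor <;> linarith [n1.1, n1.2, n2.1, n2.2]
  by_contra hne
  have hpos : 0 < |⟪A', A⟫| := abs_pos.2 hne
  have hK : 0 < 2 + 3 * ‖A'‖ := by positivity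
  have := bound (|⟪A', A⟫| / 2 / (2 + 3 * ‖A'‖)) (by positivity)
  rw [div_mul_cancel₀ _ hK.ne'] at this
  linarith

/-! ### Weak derivatives of smooth functions and the steady state -/

lemma hasWeakPartial_of_contDiff (h₁ : 0 < L₁) (h₂ : 0 < L₂) {e : ℝ × ℝ} (he : e = e₁ ∨ e = e₂)
    {u w : ℝ × ℝ → ℝ} (hu : ContDiff ℝ ∞ u) (hp : ∀ x y, u (x, y + L₂) = u (x, y))
    (hw : Continuous w) (hd : ∀ p, fderiv ℝ u p e = w p) :
    HasWeakPartial e ((memLp_of_continuous L₁ L₂ hu.continuous).toLp u)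
      ((memLp_of_continuous L₁ L₂ hw).toLp w) := by
  rw [hasWeakPartial_iff]
  intro φ h
  have hc := h.continuous
  have hc' := (h.fderiv_apply e).continuous
  have hcu := hu.continuous
  rw [inner_eq_integral_of_ae (MemLp.coeFn_toLp _) (h.fderiv_apply e).coeFn_toL2,
    inner_eq_integral_of_ae (MemLp.coeFn_toLp _) h.coeFn_toL2, ← add_eq_zero_iff_eq_neg,
    ← integral_add (integrable_of_continuous (by fun_prop))
      (integrable_of_continuous (by fun_prop))]
  have hprod := h.mul_left hu hp
  have hzero : ∫ p, fderiv ℝ (fun p => u p * φ p) p e ∂(cylMeasure L₁ L₂) = 0 := by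
    rcases he with rfl | rfl
    · exact hprod.integral_fderiv_fst h₁ h₂
    · exact hprod.integral_fderiv_snd h₁ h₂
  rw [← hzero]
  congr 1 with p
  rw [fderiv_fun_mul (hu.differentiable (by simp) p) (h.differentiable p)]
  simp [hd, mul_comm]

/-- The class in `L²` of a constant. -/
def constL2 (L₁ L₂ κ : ℝ) : L2Cyl L₁ L₂ :=
  (memLp_of_continuous L₁ L₂ (f := fun _ => κ) continuous_const).toLp _

lemma constL2_zero : constL2 L₁ L₂ 0 = 0 :=
  MemLp.toLp_zero _

lemma hasWeakPartial_constL2 (h₁ : 0 < L₁) (h₂ : 0 < L₂) {e : ℝ × ℝ} (he : e = e₁ ∨ e = e₂)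
    (κ : ℝ) : HasWeakPartial e (constL2 L₁ L₂ κ) 0 := by
  have := hasWeakPartial_of_contDiff h₁ h₂ he (u := fun _ => κ) (w := fun _ => 0)
    contDiff_const (fun _ _ => rfl) continuous_const (by simp)
  rw [← constL2_zero]
  exact this

lemma hasWeakPartial_fst_rhoSSPlus (h₁ : 0 < L₁) (h₂ : 0 < L₂) :
    HasWeakPartial e₁ (rhoSSPlus L₁ L₂) (constL2 L₁ L₂ (-(1 / L₁))) := by
  refine hasWeakPartial_of_contDiff h₁ h₂ (Or.inl rfl) (u := fun p => 1 - p.1 / L₁) (by fun_prop)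
    (fun _ _ => rfl) continuous_const fun p => ?_
  have : HasFDerivAt (fun p : ℝ × ℝ => 1 - p.1 / L₁)
      (-(L₁⁻¹ • ContinuousLinearMap.fst ℝ ℝ ℝ)) p := by
    simpa [div_eq_inv_mul] using
      ((hasFDerivAt_fst (𝕜 := ℝ) (p := p)).const_smul L₁⁻¹).const_sub 1
  simp [this.fderiv, e₁]

lemma hasWeakPartial_snd_rhoSSPlus (h₁ : 0 < L₁) (h₂ : 0 < L₂) :
    HasWeakPartial e₂ (rhoSSPlus L₁ L₂) 0 := by
  rw [← constL2_zero]
  refine hasWeakPartial_of_contDiff h₁ h₂ (Or.inr rfl) (u := fun p => 1 - p.1 / L₁) (by fun_prop)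
    (fun _ _ => rfl) continuous_const fun p => ?_
  have : HasFDerivAt (fun p : ℝ × ℝ => 1 - p.1 / L₁)
      (-(L₁⁻¹ • ContinuousLinearMap.fst ℝ ℝ ℝ)) p := by
    simpa [div_eq_inv_mul] using
      ((hasFDerivAt_fst (𝕜 := ℝ) (p := p)).const_smul L₁⁻¹).const_sub 1
  simp [this.fderiv, e₂]

lemma rhoSSPlus_add_rhoSSMinus : rhoSSPlus L₁ L₂ + rhoSSMinus L₁ L₂ = constL2 L₁ L₂ 1 := by
  rw [rhoSSPlus, rhoSSMinus, ← MemLp.toLp_add, constL2]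
  congr 1
  funext p
  simp

lemma hasWeakPartial_fst_rhoSSMinus (h₁ : 0 < L₁) (h₂ : 0 < L₂) :
    HasWeakPartial e₁ (rhoSSMinus L₁ L₂) (constL2 L₁ L₂ (1 / L₁)) := by
  have h := (hasWeakPartial_constL2 h₁ h₂ (Or.inl rfl) 1).sub (hasWeakPartial_fst_rhoSSPlus h₁ h₂)
  rw [← rhoSSPlus_add_rhoSSMinus, add_sub_cancel_left] at h
  convert h using 1
  rw [zero_sub, constL2, constL2, ← MemLp.toLp_neg]
  congr 1
  funext p
  simp

lemma hasWeakPartial_snd_rhoSSMinus (h₁ : 0 < L₁) (h₂ : 0 < L₂) :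
    HasWeakPartial e₂ (rhoSSMinus L₁ L₂) 0 := by
  have h := (hasWeakPartial_constL2 h₁ h₂ (Or.inr rfl) 1).sub (hasWeakPartial_snd_rhoSSPlus h₁ h₂)
  rwa [← rhoSSPlus_add_rhoSSMinus, add_sub_cancel_left, sub_zero] at h

lemma memH2_of_affine (h₁ : 0 < L₁) (h₂ : 0 < L₂) {R : L2Cyl L₁ L₂} {κ : ℝ}
    (hR₁ : HasWeakPartial e₁ R (constL2 L₁ L₂ κ)) (hR₂ : HasWeakPartial e₂ R 0) : MemH2 R :=
  ⟨_, _, hR₁, hR₂, ⟨0, 0, hasWeakPartial_constL2 h₁ h₂ (.inl rfl) κ,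
    hasWeakPartial_constL2 h₁ h₂ (.inr rfl) κ⟩, ⟨0, 0, .zero _, .zero _⟩⟩

lemma transportRHS_of_affine (h₁ : 0 < L₁) (h₂ : 0 < L₂) {R : L2Cyl L₁ L₂} {κ : ℝ} (ν T : ℝ)
    (hR₁ : HasWeakPartial e₁ R (constL2 L₁ L₂ κ)) (hR₂ : HasWeakPartial e₂ R 0) :
    TransportRHS ν T 0 0 R 0 := by
  refine ⟨_, _, 0, hR₁, hR₂, ⟨_, _, 0, 0, hR₁, hR₂, hasWeakPartial_constL2 h₁ h₂ (.inl rfl) κ,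
    .zero _, (add_zero 0).symm⟩, ?_⟩
  filter_upwards [Lp.coeFn_zero ℝ 2 (cylMeasure L₁ L₂)] with p hp
  rw [hp]
  simp

/-- The steady state solves the system. -/
lemma isSolution_rhoSS (h₁ : 0 < L₁) (h₂ : 0 < L₂) (ν Tp Tm : ℝ) :
    IsSolution (L₁ := L₁) (L₂ := L₂) ν Tp Tm ⊤
      (fun _ => rhoSSPlus L₁ L₂) (fun _ => rhoSSMinus L₁ L₂) (fun _ => 0) := by
  have p₁ := hasWeakPartial_fst_rhoSSPlus h₁ h₂
  have p₂ := hasWeakPartial_snd_rhoSSPlus h₁ h₂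
  have m₁ := hasWeakPartial_fst_rhoSSMinus h₁ h₂
  have m₂ := hasWeakPartial_snd_rhoSSMinus h₁ h₂
  refine ⟨by simp, continuousWithinAt_const, continuousWithinAt_const, fun t _ _ =>
    ⟨0, 0, hasDerivAt_const _ _, hasDerivAt_const _ _, memH2_of_affine h₁ h₂ p₁ p₂,
      memH2_of_affine h₁ h₂ m₁ m₂, ?_, ?_, ?_, ?_⟩⟩
  · rw [sub_self]; exact memH10_zero h₁
  · rw [sub_self]; exact memH10_zero h₁
  · refine ⟨⟨0, 0, .zero _, .zero _, ⟨0, 0, .zero _, .zero _⟩, ⟨0, 0, .zero _, .zero _⟩⟩,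
      memH10_zero h₁, 0, ⟨0, 0, 0, 0, .zero _, .zero _, .zero _, .zero _, (add_zero 0).symm⟩, ?_⟩
    have hsum : constL2 L₁ L₂ 1 =ᵐ[cylMeasure L₁ L₂] fun _ => (1 : ℝ) := MemLp.coeFn_toLp _
    rw [← rhoSSPlus_add_rhoSSMinus] at hsum
    filter_upwards [Lp.coeFn_zero ℝ 2 (cylMeasure L₁ L₂), hsum,
      Lp.coeFn_add (rhoSSPlus L₁ L₂) (rhoSSMinus L₁ L₂)] with p hp h1 h2
    rw [hp, ← Pi.add_apply, ← h2, h1]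
    simp
  · refine ⟨0, 0, ?_, ?_, transportRHS_of_affine h₁ h₂ ν Tp p₁ p₂,
      transportRHS_of_affine h₁ h₂ ν Tm m₁ m₂⟩ <;>
    · rw [neg_zero]; exact .zero _

/-! ### The Poisson problem -/

/-- `V ∈ H¹₀`, with partial derivatives `V₁` and `V₂`, is a weak solution of `-∇²V = σ`. -/
structure IsWeakPotential (σ V V₁ V₂ : L2Cyl L₁ L₂) : Prop where
  limit : IsH10Limit V V₁ V₂
  weak : ∀ b b₁ b₂, IsH10Limit b b₁ b₂ → ⟪V₁, b₁⟫ + ⟪V₂, b₂⟫ = ⟪σ, b⟫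

namespace IsWeakPotential

variable {σ V V₁ V₂ σ' V' V₁' V₂' : L2Cyl L₁ L₂}

lemma inner_self (h : IsWeakPotential σ V V₁ V₂) : ‖V₁‖ ^ 2 + ‖V₂‖ ^ 2 = ⟪V, σ⟫ := by
  rw [← real_inner_self_eq_norm_sq, ← real_inner_self_eq_norm_sq, h.weak _ _ _ h.limit,
    real_inner_comm]

/-- Symmetry of the inverse Laplacian: both sides equal ⟪∇V, ∇V'⟫. -/
lemma inner_comm (h : IsWeakPotential σ V V₁ V₂) (h' : IsWeakPotential σ' V' V₁' V₂') :
    ⟪V, σ'⟫ = ⟪V', σ⟫ := by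
  rw [← real_inner_comm V, ← real_inner_comm V', ← h'.weak _ _ _ h.limit,
    ← h.weak _ _ _ h'.limit, real_inner_comm V₁, real_inner_comm V₂]

lemma sub (h : IsWeakPotential σ V V₁ V₂) (h' : IsWeakPotential σ' V' V₁' V₂') :
    IsWeakPotential (σ - σ') (V - V') (V₁ - V₁') (V₂ - V₂') := by
  refine ⟨by simpa [← sub_eq_add_neg] using h.limit.add_smul (-1) h'.limit,
    fun b b₁ b₂ hb => ?_⟩
  rw [inner_sub_left, inner_sub_left, inner_sub_left, ← h.weak _ _ _ hb, ← h'.weak _ _ _ hb]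
  ring

/-- Poincaré and Cauchy–Schwarz give μ‖V‖² ≤ ‖∇V‖² = ⟪V, σ⟫ ≤ ‖V‖‖σ‖, with μ = (π/L₁)². -/
lemma norm_le (h₁ : 0 < L₁) (h₂ : 0 < L₂) (h : IsWeakPotential σ V V₁ V₂) :
    (Real.pi / L₁) ^ 2 * ‖V‖ ≤ ‖σ‖ := by
  have hp := h.limit.poincare h₁ h₂
  have hi := h.inner_self
  have hcs := real_inner_le_norm V σ
  rcases (norm_nonneg V).eq_or_lt with h0 | h0
  · rw [← h0]; simp
  · refine le_of_mul_le_mul_left ?_ h0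
    nlinarith [sq_nonneg ‖V₂‖]

lemma inner_le (h₁ : 0 < L₁) (h₂ : 0 < L₂) (h : IsWeakPotential σ V V₁ V₂) :
    (Real.pi / L₁) ^ 2 * ⟪V, σ⟫ ≤ ‖σ‖ ^ 2 := by
  have hn := h.norm_le h₁ h₂
  have hcs := real_inner_le_norm V σ
  have hμ : 0 ≤ (Real.pi / L₁) ^ 2 := by positivity
  nlinarith [norm_nonneg σ, mul_le_mul_of_nonneg_left hcs hμ,
    mul_le_mul_of_nonneg_right hn (norm_nonneg σ)]

lemma inner_nonneg (h : IsWeakPotential σ V V₁ V₂) : 0 ≤ ⟪V, σ⟫ := by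
  rw [← h.inner_self]; positivity

end IsWeakPotential

/-- The charge exerts no net force on itself in the periodic direction. Since V is a limit of test
functions, ⟪∂₁∂₁V, ∂₂V⟫ = ⟪∂₁∂₂V, ∂₁V⟫ without boundary terms, and skew-symmetry of ∂₂ applied to
∂₁V and to ∂₂V, neither of which is assumed to lie in H¹₀, removes both contributions. -/
lemma inner_snd_laplacian_eq_zero (h₁ : 0 < L₁) (h₂ : 0 < L₂) {V V₁ V₂ V₁₁ V₁₂ V₂₂ : L2Cyl L₁ L₂}
    (hV : IsH10Limit V V₁ V₂) (h₁₁ : HasWeakPartial e₁ V₁ V₁₁) (h₁₂ : HasWeakPartial e₂ V₁ V₁₂)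
    (h₂₂ : HasWeakPartial e₂ V₂ V₂₂) : ⟪V₂, V₁₁ + V₂₂⟫ = 0 := by
  have hcross : ⟪V₁₁, V₂⟫ = ⟪V₁₂, V₁⟫ := by
    obtain ⟨φ, h, t, t₁, t₂⟩ := hV
    rw [hasWeakPartial_iff] at h₁₁ h₁₂
    refine tendsto_nhds_unique ((tendsto_const_nhds (x := V₁₁)).inner t₂) ?_
    refine ((tendsto_const_nhds (x := V₁₂)).inner t₁).congr fun n => ?_
    have i1 := h₁₁ _ ((h n).fderiv_apply e₂)
    have i2 := h₁₂ _ ((h n).fderiv_apply e₁)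
    have i3 : ⟪V₁, (((h n).fderiv_apply e₂).fderiv_apply e₁).toL2⟫ =
        ⟪V₁, (((h n).fderiv_apply e₁).fderiv_apply e₂).toL2⟫ := by
      simp only [IsTest.inner_toL2, (h n).fderiv_fderiv_comm _ e₂ e₁]
    linarith
  rw [inner_add_right, real_inner_comm V₁₁, hcross, h₁₂.inner_self_eq_zero h₁ h₂,
    real_inner_comm V₂₂, h₂₂.inner_self_eq_zero h₁ h₂, add_zero]

/-- The steady densities add up to the background 1, so V is the potential of the perturbations
alone. Uniqueness of weak derivatives identifies the various witnesses for ∇V. -/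
lemma IsPotential.exists_isWeakPotential (h₁ : 0 < L₁) (h₂ : 0 < L₂) {ρp ρm V V₁ V₂ : L2Cyl L₁ L₂}
    (hV : IsPotential ρp ρm V) (hV₁ : HasWeakPartial e₁ V V₁) (hV₂ : HasWeakPartial e₂ V V₂) :
    ∃ V₁₁ V₂₂, HasWeakPartial e₁ V₁ V₁₁ ∧ HasWeakPartial e₂ V₂ V₂₂ ∧
      -(V₁₁ + V₂₂) = (ρp - rhoSSPlus L₁ L₂) + (ρm - rhoSSMinus L₁ L₂) ∧
      IsWeakPotential ((ρp - rhoSSPlus L₁ L₂) + (ρm - rhoSSMinus L₁ L₂)) V V₁ V₂ ∧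
      ⟪V₂, (ρp - rhoSSPlus L₁ L₂) + (ρm - rhoSSMinus L₁ L₂)⟫ = 0 := by
  obtain ⟨⟨a₁, a₂, ha₁, ha₂, ⟨a₁₁, a₁₂, ha₁₁, ha₁₂⟩, -⟩, h10, ΔV,
    ⟨c₁, c₂, c₁₁, c₂₂, hc₁, hc₂, hc₁₁, hc₂₂, rfl⟩, hρ⟩ := hV
  obtain ⟨b₁, b₂, hb₁, hb₂, hlim⟩ := h10.exists_isH10Limit
  obtain rfl := ha₁.unique h₁ h₂ hV₁
  obtain rfl := hb₁.unique h₁ h₂ hV₁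
  obtain rfl := hc₁.unique h₁ h₂ hV₁
  obtain rfl := hb₂.unique h₁ h₂ hV₂
  obtain rfl := hc₂.unique h₁ h₂ hV₂
  have hσ : -(c₁₁ + c₂₂) = (ρp - rhoSSPlus L₁ L₂) + (ρm - rhoSSMinus L₁ L₂) := by
    have e1 : (ρp - rhoSSPlus L₁ L₂) + (ρm - rhoSSMinus L₁ L₂) =
        ρp + ρm - constL2 L₁ L₂ 1 := by
      rw [← rhoSSPlus_add_rhoSSMinus]; abel
    have hone : constL2 L₁ L₂ 1 =ᵐ[cylMeasure L₁ L₂] fun _ => (1 : ℝ) := MemLp.coeFn_toLp _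
    rw [e1]
    refine Lp.ext ?_
    filter_upwards [hρ, hone, Lp.coeFn_neg (c₁₁ + c₂₂), Lp.coeFn_add ρp ρm,
      Lp.coeFn_sub (ρp + ρm) (constL2 L₁ L₂ 1)] with p i1 i2 i3 i4 i5
    rw [i3, i5, Pi.neg_apply, Pi.sub_apply, i4, Pi.add_apply, i2, i1]
  refine ⟨c₁₁, c₂₂, hc₁₁, hc₂₂, hσ, ⟨hlim, fun b b₁ b₂ hb => ?_⟩, ?_⟩
  · rw [← hσ, hb.inner_fst hc₁₁, hb.inner_snd hc₂₂, inner_neg_left, inner_add_left]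
    ring
  · rw [← hσ, inner_neg_right, inner_snd_laplacian_eq_zero h₁ h₂ hlim hc₁₁ ha₁₂ hc₂₂, neg_zero]

/-! ### Energy identities -/

/-- The equation satisfied by the perturbation `f = ρ - R` of a shear profile `R` of slope `κ`. -/
lemma TransportRHS.perturbation (h₁ : 0 < L₁) (h₂ : 0 < L₂) {ν T κ : ℝ}
    {E₁ E₂ ρ R r : L2Cyl L₁ L₂}
    (hR₁ : HasWeakPartial e₁ R (constL2 L₁ L₂ κ)) (hR₂ : HasWeakPartial e₂ R 0)
    (hρ : MemH10 (ρ - R)) (hT : TransportRHS ν T E₁ E₂ ρ r) :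
    ∃ f₁ f₂ f₁₁ f₂₂ N : L2Cyl L₁ L₂, IsH10Limit (ρ - R) f₁ f₂ ∧
      HasWeakPartial e₁ (ρ - R) f₁ ∧ HasWeakPartial e₂ (ρ - R) f₂ ∧
      HasWeakPartial e₁ f₁ f₁₁ ∧ HasWeakPartial e₂ f₂ f₂₂ ∧
      r = T • f₂ - N + ν • (f₁₁ + f₂₂) - κ • E₂ ∧
      ∀ᵐ p ∂(cylMeasure L₁ L₂), N p = (-E₁) p * f₂ p - (-E₂) p * f₁ p := by
  obtain ⟨ρ₁, ρ₂, Δρ, hρ₁, hρ₂, ⟨c₁, c₂, c₁₁, c₂₂, hc₁, hc₂, hc₁₁, hc₂₂, rfl⟩, hr⟩ := hT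
  obtain rfl := hc₁.unique h₁ h₂ hρ₁
  obtain rfl := hc₂.unique h₁ h₂ hρ₂
  obtain ⟨f₁, f₂, w₁, w₂, hlim⟩ := hρ.exists_isH10Limit
  obtain rfl := w₁.unique h₁ h₂ (hρ₁.sub hR₁)
  have e2 := w₂.unique h₁ h₂ (hρ₂.sub hR₂)
  rw [sub_zero] at e2
  subst e2
  have h11 := hc₁₁.sub (hasWeakPartial_constL2 h₁ h₂ (.inl rfl) κ)
  rw [sub_zero] at h11
  -- The transport term N is defined as what the equation leaves over, which puts it in L² with no
  -- estimate on the product E^⊥ · ∇f.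
  refine ⟨_, _, c₁₁, c₂₂, T • f₂ + ν • (c₁₁ + c₂₂) - κ • E₂ - r, hlim, w₁, w₂, h11, hc₂₂,
    by abel, ?_⟩
  have hκ : constL2 L₁ L₂ κ =ᵐ[cylMeasure L₁ L₂] fun _ => κ := MemLp.coeFn_toLp _
  filter_upwards [hr, hκ, Lp.coeFn_sub (T • f₂ + ν • (c₁₁ + c₂₂) - κ • E₂) r,
    Lp.coeFn_sub (T • f₂ + ν • (c₁₁ + c₂₂)) (κ • E₂), Lp.coeFn_add (T • f₂) (ν • (c₁₁ + c₂₂)),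
    Lp.coeFn_smul T f₂, Lp.coeFn_smul ν (c₁₁ + c₂₂), Lp.coeFn_smul κ E₂, Lp.coeFn_neg E₁,
    Lp.coeFn_neg E₂, Lp.coeFn_sub c₁ (constL2 L₁ L₂ κ)] with p i1 i2 i3 i4 i5 i6 i7 i8 i9 i10 i11
  rw [i3, Pi.sub_apply, i4, Pi.sub_apply, i5, Pi.add_apply, i6, i7, i8, i9, i10, i11, i1]
  simp only [Pi.smul_apply, Pi.neg_apply, Pi.sub_apply, smul_eq_mul, i2]
  ring

/-- Energy identities for the perturbation of one fluid. -/
lemma TransportRHS.energy (h₁ : 0 < L₁) (h₂ : 0 < L₂) {ν T κ : ℝ}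
    {E₁ E₂ ρ R r V V₁₁ V₂₂ : L2Cyl L₁ L₂}
    (hR₁ : HasWeakPartial e₁ R (constL2 L₁ L₂ κ)) (hR₂ : HasWeakPartial e₂ R 0)
    (hρ : MemH10 (ρ - R)) (hT : TransportRHS ν T E₁ E₂ ρ r)
    (hV₁ : HasWeakPartial e₁ V (-E₁)) (hV₂ : HasWeakPartial e₂ V (-E₂))
    (hV : IsH10Limit V (-E₁) (-E₂))
    (hV₁₁ : HasWeakPartial e₁ (-E₁) V₁₁) (hV₂₂ : HasWeakPartial e₂ (-E₂) V₂₂) :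
    ∃ f₁ f₂ : L2Cyl L₁ L₂, IsH10Limit (ρ - R) f₁ f₂ ∧
      ⟪ρ - R, r⟫ = -ν * (‖f₁‖ ^ 2 + ‖f₂‖ ^ 2) - κ * ⟪E₂, ρ - R⟫ ∧
      ⟪V, r⟫ = T * ⟪E₂, ρ - R⟫ + ν * ⟪V₁₁ + V₂₂, ρ - R⟫ := by
  obtain ⟨f₁, f₂, f₁₁, f₂₂, N, hlim, w₁, w₂, w₁₁, w₂₂, hr, hN⟩ :=
    hT.perturbation h₁ h₂ hR₁ hR₂ hρ
  refine ⟨f₁, f₂, hlim, ?_, ?_⟩ <;> generalize ρ - R = f at *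
  · have i1 := hlim.inner_snd w₂
    have i2 := inner_bracket_eq_zero hV₁ hV₂ hlim hN
    have i3 := hlim.inner_fst w₁₁
    have i4 := hlim.inner_snd w₂₂
    rw [real_inner_self_eq_norm_sq] at i3 i4
    rw [hr, i3, i4]
    simp only [inner_add_right, inner_sub_right, inner_smul_right]
    rw [real_inner_comm f₂ f] at i1
    have i5 : ⟪f₂, f⟫ = 0 := by linarith
    rw [← real_inner_comm f f₂, ← real_inner_comm f N,
      ← real_inner_comm f f₁₁, ← real_inner_comm f f₂₂,
      ← real_inner_comm f E₂, i2, i5]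
    ring
  · have i1 := hlim.inner_snd hV₂
    -- The bracket is antisymmetric: -N is the bracket of f with V, so the same lemma now gives
    -- orthogonality to V.
    have i2 : ⟪-N, V⟫ = 0 := by
      refine inner_bracket_eq_zero w₁ w₂ hV ?_
      filter_upwards [hN, Lp.coeFn_neg N] with p j1 j2
      rw [j2, Pi.neg_apply, j1]; ring
    -- Green's identity, with both f and V in H¹₀, moves the Laplacian from f to V.
    have i3 := hV.inner_fst w₁₁
    have i4 := hV.inner_snd w₂₂
    have i5 := hlim.inner_fst hV₁₁
    have i6 := hlim.inner_snd hV₂₂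
    have i7 := hV.inner_snd hV₂
    rw [real_inner_comm] at i3 i4
    rw [real_inner_comm, inner_neg_left] at i7
    rw [inner_neg_left, neg_neg] at i1
    rw [inner_neg_left, neg_eq_zero] at i2
    have i8 : ⟪E₂, V⟫ = 0 := by linarith
    have i9 : ⟪f₁₁, V⟫ = ⟪V₁₁, f⟫ := by linarith
    have i10 : ⟪f₂₂, V⟫ = ⟪V₂₂, f⟫ := by linarith
    rw [hr, inner_add_left V₁₁]
    simp only [inner_add_right, inner_sub_right, inner_smul_right]
    rw [i1, ← real_inner_comm V N, i2, ← real_inner_comm V f₁₁, i9, ← real_inner_comm V f₂₂, i10,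
      ← real_inner_comm V E₂, i8]
    ring

/-- Here S and D stand for ‖f + g‖² and ‖f - g‖², indexed versions for their partial derivatives,
and P for ‖∇V‖². The difference part needs only D₁ ≥ μD. For the sum, `hgrad` gives S₁ + S₂ ≥ μS +
μ(S - μP), and μ(S - μP) ≥ 4c(S - μP) because S ≥ μP. -/
lemma dissipation_arith {μ c P S D S₁ D₁ S₂ D₂ nf ng nf₁ ng₁ nf₂ ng₂ : ℝ} (hcμ : 4 * c ≤ μ)
    (hP : μ * P ≤ S) (hD : μ * D ≤ D₁) (hD₂ : 0 ≤ D₂)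
    (hgrad : 0 ≤ S₁ + S₂ - 2 * μ * S + μ ^ 2 * P) (par : S + D = 2 * (nf + ng))
    (par₁ : S₁ + D₁ = 2 * (nf₁ + ng₁)) (par₂ : S₂ + D₂ = 2 * (nf₂ + ng₂)) :
    2 * c * S - (nf₁ + nf₂ + (ng₁ + ng₂)) ≤ -(2 * μ) * ((nf + ng) / 2 - c * P) := by
  have hspec : 2 * c * (S - μ * P) ≤ μ / 2 * (S - μ * P) :=
    mul_le_mul_of_nonneg_right (by linarith) (by linarith)
  have e : nf + ng = (S + D) / 2 := by linarith
  rw [e]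
  linarith

/-- The dissipation inequality for the Lyapunov functional
`(‖f‖² + ‖g‖²) / 2 - c ‖∇V‖²`, where `f` and `g` are the perturbations of the two densities. -/
lemma SatisfiesAt.dissipation (h₁ : 0 < L₁) (h₂ : 0 < L₂) {ν c Tp Tm : ℝ} (hν : 0 < ν)
    (hc : c * (L₁ * (Tp - Tm)) = 1) (hcμ : 4 * c ≤ (Real.pi / L₁) ^ 2)
    {ρp ρm V dρp dρm : L2Cyl L₁ L₂} (h : SatisfiesAt ν Tp Tm ρp ρm V dρp dρm) :
    ∃ V₁ V₂, IsWeakPotential ((ρp - rhoSSPlus L₁ L₂) + (ρm - rhoSSMinus L₁ L₂)) V V₁ V₂ ∧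
      ⟪ρp - rhoSSPlus L₁ L₂, dρp⟫ + ⟪ρm - rhoSSMinus L₁ L₂, dρm⟫ - c * (2 * ⟪V, dρp + dρm⟫) ≤
        -(2 * (Real.pi / L₁) ^ 2 * ν) * (distSq ρp ρm / 2 -
          c * ⟪V, (ρp - rhoSSPlus L₁ L₂) + (ρm - rhoSSMinus L₁ L₂)⟫) := by
  obtain ⟨E₁, E₂, hV₁, hV₂, hTp, hTm⟩ := h.evolution
  obtain ⟨V₁₁, V₂₂, hV₁₁, hV₂₂, hσ, hpot, hcancel⟩ :=
    h.poisson.exists_isWeakPotential h₁ h₂ hV₁ hV₂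
  obtain ⟨f₁, f₂, hf, ef, pf⟩ := hTp.energy h₁ h₂ (hasWeakPartial_fst_rhoSSPlus h₁ h₂)
    (hasWeakPartial_snd_rhoSSPlus h₁ h₂) h.boundary_plus hV₁ hV₂ hpot.limit hV₁₁ hV₂₂
  obtain ⟨g₁, g₂, hg, eg, pg⟩ := hTm.energy h₁ h₂ (hasWeakPartial_fst_rhoSSMinus h₁ h₂)
    (hasWeakPartial_snd_rhoSSMinus h₁ h₂) h.boundary_minus hV₁ hV₂ hpot.limit hV₁₁ hV₂₂
  refine ⟨_, _, hpot, ?_⟩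
  rw [distSq]
  set f := ρp - rhoSSPlus L₁ L₂
  set g := ρm - rhoSSMinus L₁ L₂
  have hLap : V₁₁ + V₂₂ = -(f + g) := by rw [← hσ, neg_neg]
  rw [hLap, inner_neg_left] at pf pg
  rw [inner_neg_left, neg_eq_zero, inner_add_right] at hcancel
  have hnorm : ⟪f + g, f⟫ + ⟪f + g, g⟫ = ‖f + g‖ ^ 2 := by
    rw [← inner_add_right, real_inner_self_eq_norm_sq]
  have hsum := hf.add_smul 1 hg
  have hdiff := hf.add_smul (-1) hg
  simp only [one_smul, neg_smul, ← sub_eq_add_neg] at hsum hdiff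
  have hPd := hdiff.poincare h₁ h₂
  have hVσ := hpot.inner_le h₁ h₂
  have hself := hpot.inner_self
  have hweak := hpot.weak _ _ _ hsum
  rw [real_inner_self_eq_norm_sq] at hweak
  set μ := (Real.pi / L₁) ^ 2
  have hμ : 0 ≤ μ := sq_nonneg _
  have q₁ := norm_sub_sq_real (f₁ + g₁) (μ • (-E₁))
  have q₂ := norm_sub_sq_real (f₂ + g₂) (μ • (-E₂))
  rw [inner_smul_right, norm_smul, mul_pow, Real.norm_eq_abs, sq_abs, real_inner_comm] at q₁ q₂
  -- This is ‖∇(σ - μV)‖² ≥ 0 expanded; on an eigenmode of -∇² with eigenvalue λ it reads (λ - μ)²/λ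
  -- ≥ 0.
  have hgrad : 0 ≤ ‖f₁ + g₁‖ ^ 2 + ‖f₂ + g₂‖ ^ 2 - 2 * μ * ‖f + g‖ ^ 2 + μ ^ 2 * ⟪V, f + g⟫ := by
    have s₁ := sq_nonneg ‖f₁ + g₁ - μ • (-E₁)‖
    have s₂ := sq_nonneg ‖f₂ + g₂ - μ • (-E₂)‖
    rw [← hself, ← hweak]
    linarith
  have par := parallelogram_law_with_norm ℝ f g
  have par₁ := parallelogram_law_with_norm ℝ f₁ g₁
  have par₂ := parallelogram_law_with_norm ℝ f₂ g₂
  have hdiss : 2 * c * ‖f + g‖ ^ 2 - (‖f₁‖ ^ 2 + ‖f₂‖ ^ 2 + (‖g₁‖ ^ 2 + ‖g₂‖ ^ 2)) ≤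
      -(2 * μ) * ((‖f‖ ^ 2 + ‖g‖ ^ 2) / 2 - c * ⟪V, f + g⟫) := by
    exact dissipation_arith hcμ hVσ hPd (sq_nonneg ‖f₂ - g₂‖) hgrad par par₁ par₂
  have hident : ⟪f, dρp⟫ + ⟪g, dρm⟫ - c * (2 * ⟪V, dρp + dρm⟫) =
      ν * (2 * c * ‖f + g‖ ^ 2 - (‖f₁‖ ^ 2 + ‖f₂‖ ^ 2 + (‖g₁‖ ^ 2 + ‖g₂‖ ^ 2))) := by
    have hg' : ⟪E₂, g⟫ = -⟪E₂, f⟫ := by linarith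
    -- This value of c cancels the ⟪E₂, f⟫ terms coming from the L² norms against those from the
    -- field energy.
    have hcL : 1 / L₁ = c * (Tp - Tm) := by
      rw [div_eq_iff h₁.ne', ← hc]; ring
    rw [inner_add_right V, ef, eg, pf, pg, hg', ← hnorm, hcL]
    ring
  rw [hident]
  calc _ ≤ ν * (-(2 * μ) * ((‖f‖ ^ 2 + ‖g‖ ^ 2) / 2 - c * ⟪V, f + g⟫)) :=
        mul_le_mul_of_nonneg_left hdiss hν.le
    _ = _ := by ring

/-! ### Evolution of the Lyapunov functional -/

/-- The electrostatic energy of a differentiable family of charge densities is differentiable. -/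
lemma hasDerivAt_inner_potential (h₁ : 0 < L₁) (h₂ : 0 < L₂) {σ V : ℝ → L2Cyl L₁ L₂}
    {σ' : L2Cyl L₁ L₂} {t : ℝ}
    (hpot : ∀ᶠ s in 𝓝 t, ∃ V₁ V₂, IsWeakPotential (σ s) (V s) V₁ V₂) (hσ : HasDerivAt σ σ' t) :
    HasDerivAt (fun s => ⟪V s, σ s⟫) (2 * ⟪V t, σ'⟫) t := by
  obtain ⟨W₁, W₂, hW⟩ := hpot.self_of_nhds
  have hμ : 0 < (Real.pi / L₁) ^ 2 := by have := Real.pi_pos; positivity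
  have hVc : Tendsto V (𝓝 t) (𝓝 (V t)) := by
    rw [tendsto_iff_norm_sub_tendsto_zero]
    have hlim : Tendsto (fun s => ‖σ s - σ t‖ / (Real.pi / L₁) ^ 2) (𝓝 t) (𝓝 0) := by
      simpa using (tendsto_iff_norm_sub_tendsto_zero.1 hσ.continuousAt.tendsto).div_const
        ((Real.pi / L₁) ^ 2)
    refine squeeze_zero' (Eventually.of_forall fun s => norm_nonneg _) ?_ hlim
    filter_upwards [hpot] with s hs
    obtain ⟨V₁, V₂, hV⟩ := hs
    rw [le_div_iff₀ hμ, mul_comm]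
    exact (hV.sub hW).norm_le h₁ h₂
  rw [hasDerivAt_iff_tendsto_slope] at hσ ⊢
  -- Symmetry gives ⟪V s, σ s⟫ - ⟪V t, σ t⟫ = ⟪V s + V t, σ s - σ t⟫, so continuity of V suffices
  -- and V need not be differentiated.
  have hlim : Tendsto (fun s => ⟪V s + V t, slope σ t s⟫) (𝓝[≠] t) (𝓝 (2 * ⟪V t, σ'⟫)) := by
    have := Tendsto.inner (𝕜 := ℝ) ((hVc.mono_left nhdsWithin_le_nhds).add_const (V t)) hσ
    rwa [inner_add_left, ← two_mul] at this
  refine hlim.congr' ?_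
  filter_upwards [nhdsWithin_le_nhds hpot] with s hs
  obtain ⟨V₁, V₂, hV⟩ := hs
  have hsymm := hV.inner_comm hW
  rw [slope_def_module, slope_def_module, inner_smul_right, inner_sub_right, inner_add_left,
    inner_add_left, hsymm, smul_eq_mul]
  ring

/-- The field energy lies between 0 and ‖f + g‖²/μ ≤ 2(‖f‖² + ‖g‖²)/μ, where μ = (π/L₁)². A negative
c only helps the lower bound, hence `max c 0`; the lower constant is positive exactly when 4c < μ.
-/
lemma IsWeakPotential.functional_bounds (h₁ : 0 < L₁) (h₂ : 0 < L₂) {f g V V₁ V₂ : L2Cyl L₁ L₂}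
    (h : IsWeakPotential (f + g) V V₁ V₂) (c : ℝ) :
    (1 / 2 - 2 * max c 0 / (Real.pi / L₁) ^ 2) * (‖f‖ ^ 2 + ‖g‖ ^ 2) ≤
        (‖f‖ ^ 2 + ‖g‖ ^ 2) / 2 - c * ⟪V, f + g⟫ ∧
      (‖f‖ ^ 2 + ‖g‖ ^ 2) / 2 - c * ⟪V, f + g⟫ ≤
        (1 / 2 + 2 * |c| / (Real.pi / L₁) ^ 2) * (‖f‖ ^ 2 + ‖g‖ ^ 2) := by
  have hμ : 0 < (Real.pi / L₁) ^ 2 := by have := Real.pi_pos; positivity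
  have hP0 := h.inner_nonneg
  have hP := h.inner_le h₁ h₂
  have par := parallelogram_law_with_norm ℝ f g
  set D := ‖f‖ ^ 2 + ‖g‖ ^ 2 with hD
  have hPD : ⟪V, f + g⟫ ≤ 2 * D / (Real.pi / L₁) ^ 2 := by
    rw [le_div_iff₀ hμ]
    nlinarith [sq_nonneg ‖f - g‖]
  have b1 : c * ⟪V, f + g⟫ ≤ max c 0 * (2 * D / (Real.pi / L₁) ^ 2) :=
    (mul_le_mul_of_nonneg_right (le_max_left c 0) hP0).trans
      (mul_le_mul_of_nonneg_left hPD (le_max_right c 0))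
  have b2 : -c * ⟪V, f + g⟫ ≤ |c| * (2 * D / (Real.pi / L₁) ^ 2) :=
    (mul_le_mul_of_nonneg_right (neg_le_abs c) hP0).trans
      (mul_le_mul_of_nonneg_left hPD (abs_nonneg c))
  constructor
  · calc _ = D / 2 - max c 0 * (2 * D / (Real.pi / L₁) ^ 2) := by ring
      _ ≤ _ := by linarith
  · calc _ ≤ D / 2 + |c| * (2 * D / (Real.pi / L₁) ^ 2) := by linarith
      _ = _ := by ring

lemma distSq_nonneg (ρp ρm : L2Cyl L₁ L₂) : 0 ≤ distSq ρp ρm := by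
  rw [distSq]; positivity

/-- The exponential decay estimate with explicit constants. -/
lemma IsSolution.decay (h₁ : 0 < L₁) (h₂ : 0 < L₂) {ν c Tp Tm : ℝ} (hν : 0 < ν)
    (hc : c * (L₁ * (Tp - Tm)) = 1) (hcμ : 4 * c < (Real.pi / L₁) ^ 2) {T : EReal}
    {ρp ρm V : ℝ → L2Cyl L₁ L₂} (h : IsSolution ν Tp Tm T ρp ρm V) {t : ℝ} (ht : 0 < t)
    (htT : (t : EReal) < T) :
    (1 / 2 - 2 * max c 0 / (Real.pi / L₁) ^ 2) * distSq (ρp t) (ρm t) ≤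
      (1 / 2 + 2 * |c| / (Real.pi / L₁) ^ 2) * distSq (ρp 0) (ρm 0) *
        Real.exp (-(2 * (Real.pi / L₁) ^ 2 * ν) * t) := by
  set k := 2 * (Real.pi / L₁) ^ 2 * ν with hk
  set f : ℝ → L2Cyl L₁ L₂ := fun s => ρp s - rhoSSPlus L₁ L₂ with hf
  set g : ℝ → L2Cyl L₁ L₂ := fun s => ρm s - rhoSSMinus L₁ L₂ with hg
  set W : ℝ → ℝ := fun s => distSq (ρp s) (ρm s) / 2 - c * ⟪V s, f s + g s⟫ with hW
  have hopen : IsOpen {s : ℝ | 0 < s ∧ (s : EReal) < T} :=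
    isOpen_Ioi.inter (isOpen_Iio.preimage continuous_coe_real_ereal)
  have hpot : ∀ s : ℝ, 0 < s → (s : EReal) < T →
      ∃ V₁ V₂, IsWeakPotential (f s + g s) (V s) V₁ V₂ := fun s hs hsT => by
    obtain ⟨dρp, dρm, -, -, hsat⟩ := h.equations s hs hsT
    obtain ⟨V₁, V₂, hV, -⟩ := hsat.dissipation h₁ h₂ hν hc hcμ.le
    exact ⟨V₁, V₂, hV⟩
  have hder : ∀ s : ℝ, 0 < s → (s : EReal) < T → ∃ W', HasDerivAt W W' s ∧ W' ≤ -k * W s :=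
    fun s hs hsT => by
    obtain ⟨dρp, dρm, dp, dm, hsat⟩ := h.equations s hs hsT
    obtain ⟨-, -, -, hdiss⟩ := hsat.dissipation h₁ h₂ hν hc hcμ.le
    have df : HasDerivAt f dρp s := dp.sub_const _
    have dg : HasDerivAt g dρm s := dm.sub_const _
    have hp := hasDerivAt_inner_potential h₁ h₂ (σ := fun s => f s + g s) (V := V) (t := s)
      (by filter_upwards [hopen.mem_nhds ⟨hs, hsT⟩] with r hr using hpot r hr.1 hr.2) (df.add dg)
    refine ⟨_, ((df.norm_sq.add dg.norm_sq).div_const 2).sub (hp.const_mul c), ?_⟩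
    refine le_trans (le_of_eq ?_) hdiss
    ring
  have hmono : ∀ s : ℝ, 0 < s → s ≤ t → W t * Real.exp (k * t) ≤ W s * Real.exp (k * s) :=
    fun s hs hst => by
    have hlt : ∀ r ∈ Icc s t, 0 < r ∧ (r : EReal) < T := fun r hr =>
      ⟨hs.trans_le hr.1, lt_of_le_of_lt (EReal.coe_le_coe_iff.2 hr.2) htT⟩
    have hF : ∀ r ∈ Icc s t, ∃ F', HasDerivAt (fun r => W r * Real.exp (k * r)) F' r ∧ F' ≤ 0 :=
      fun r hr => by
      obtain ⟨W', hW', hle⟩ := hder r (hlt r hr).1 (hlt r hr).2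
      have he : HasDerivAt (fun r => Real.exp (k * r)) (Real.exp (k * r) * k) r := by
        simpa using ((hasDerivAt_id r).const_mul k).exp
      refine ⟨_, hW'.mul he, ?_⟩
      have : W' * Real.exp (k * r) + W r * (Real.exp (k * r) * k) =
          (W' + k * W r) * Real.exp (k * r) := by ring
      rw [this]
      exact mul_nonpos_of_nonpos_of_nonneg (by linarith) (Real.exp_pos _).le
    refine antitoneOn_of_deriv_nonpos (f := fun r => W r * Real.exp (k * r)) (convex_Icc s t)
      (fun r hr => ?_) (fun r hr => ?_) (fun r hr => ?_) (left_mem_Icc.2 hst)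
      (right_mem_Icc.2 hst) hst
    · obtain ⟨F', hF', -⟩ := hF r hr
      exact hF'.continuousAt.continuousWithinAt
    · obtain ⟨F', hF', -⟩ := hF r (interior_subset hr)
      exact hF'.differentiableAt.differentiableWithinAt
    · obtain ⟨F', hF', hle⟩ := hF r (interior_subset hr)
      rwa [hF'.deriv]
  set m := 1 / 2 - 2 * max c 0 / (Real.pi / L₁) ^ 2
  set K := 1 / 2 + 2 * |c| / (Real.pi / L₁) ^ 2
  -- W is traded for the distance before letting s → 0, because nothing is assumed about V at or
  -- near time 0 that would give continuity of W there; only the densities are continuous at 0.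
  have hbound : ∀ s : ℝ, 0 < s → s ≤ t → m * distSq (ρp t) (ρm t) * Real.exp (k * t) ≤
      K * distSq (ρp s) (ρm s) * Real.exp (k * s) := fun s hs hst => by
    have hsT : (s : EReal) < T := lt_of_le_of_lt (EReal.coe_le_coe_iff.2 hst) htT
    obtain ⟨V₁, V₂, hVt⟩ := hpot t ht htT
    obtain ⟨V₁', V₂', hVs⟩ := hpot s hs hsT
    calc _ ≤ W t * Real.exp (k * t) :=
          mul_le_mul_of_nonneg_right (hVt.functional_bounds h₁ h₂ c).1 (Real.exp_pos _).le
      _ ≤ W s * Real.exp (k * s) := hmono s hs hst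
      _ ≤ _ := mul_le_mul_of_nonneg_right (hVs.functional_bounds h₁ h₂ c).2 (Real.exp_pos _).le
  have hlim : Tendsto (fun s => K * distSq (ρp s) (ρm s) * Real.exp (k * s)) (𝓝[>] 0)
      (𝓝 (K * distSq (ρp 0) (ρm 0) * Real.exp (k * 0))) := by
    have cp : Tendsto ρp (𝓝[>] 0) (𝓝 (ρp 0)) := h.initial_plus.mono Ioi_subset_Ici_self
    have cm : Tendsto ρm (𝓝[>] 0) (𝓝 (ρm 0)) := h.initial_minus.mono Ioi_subset_Ici_self
    have ce : Tendsto (fun s => Real.exp (k * s)) (𝓝[>] 0) (𝓝 (Real.exp (k * 0))) :=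
      ((by fun_prop : Continuous fun s => Real.exp (k * s)).tendsto 0).mono_left
        nhdsWithin_le_nhds
    exact ((((cp.sub_const _).norm.pow 2).add ((cm.sub_const _).norm.pow 2)).const_mul K).mul ce
  have hfin := ge_of_tendsto hlim (by
    filter_upwards [Ioo_mem_nhdsGT ht] with s hs using hbound s hs.1 hs.2.le)
  rw [mul_zero, Real.exp_zero, mul_one] at hfin
  rw [neg_mul, Real.exp_neg, ← div_eq_mul_inv, le_div_iff₀ (Real.exp_pos _)]
  exact hfin

end TwoFluid

end

/-! ### Choice of constants, stability and attraction -/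

theorem theorem7p3 (L₁ ΔT : ℝ) (hL₁ : 0 < L₁)
    (hΔT : ΔT < 0 ∨ 4 * L₁ / Real.pi ^ 2 < ΔT) :
    ∃ C : ℝ, 0 < C ∧ ∀ L₂ ν Tp Tm : ℝ, 0 < L₂ → 0 < ν → Tp - Tm = ΔT →
      TwoFluid.GloballyAsymptoticallyStable L₁ L₂ ν Tp Tm ∧
      ∀ (T : EReal) (ρp ρm V : ℝ → TwoFluid.L2Cyl L₁ L₂),
        TwoFluid.IsSolution ν Tp Tm T ρp ρm V →
        ∀ t : ℝ, 0 ≤ t → (t : EReal) < T →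
          TwoFluid.distSq (ρp t) (ρm t) ≤
            C * TwoFluid.distSq (ρp 0) (ρm 0) *
              Real.exp (-(2 * Real.pi ^ 2 * ν / L₁ ^ 2) * t) := by
  have hπ := Real.pi_pos
  have hμ : 0 < (Real.pi / L₁) ^ 2 := by positivity
  have hΔ0 : ΔT ≠ 0 := by
    rcases hΔT with h | h
    · exact h.ne
    · exact (lt_trans (by positivity) h).ne'
  set c : ℝ := 1 / (L₁ * ΔT) with hc
  have hc1 : c * (L₁ * ΔT) = 1 := by
    rw [hc]; field_simp
  -- For ΔT > 0 this is the threshold ΔT > 4L₁/π² rewritten; for ΔT < 0 the left side is negative.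
  have hcμ : 4 * c < (Real.pi / L₁) ^ 2 := by
    rcases hΔT with h | h
    · have : c < 0 := one_div_neg.2 (mul_neg_of_pos_of_neg hL₁ h)
      linarith
    · have hpos : 0 < ΔT := lt_trans (by positivity) h
      rw [div_lt_iff₀ (by positivity)] at h
      rw [hc, div_pow, mul_one_div, div_lt_div_iff₀ (by positivity) (by positivity)]
      nlinarith
  set m := 1 / 2 - 2 * max c 0 / (Real.pi / L₁) ^ 2 with hm
  set K := 1 / 2 + 2 * |c| / (Real.pi / L₁) ^ 2 with hK
  have hm0 : 0 < m := by
    have : 4 * max c 0 < (Real.pi / L₁) ^ 2 := by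
      rcases max_cases c 0 with ⟨e, -⟩ | ⟨e, -⟩ <;> rw [e] <;> linarith
    rw [hm, sub_pos, div_lt_iff₀ hμ]
    linarith
  have hmK : m ≤ K := by
    have a1 : 0 ≤ 2 * max c 0 / (Real.pi / L₁) ^ 2 := by positivity
    have a2 : 0 ≤ 2 * |c| / (Real.pi / L₁) ^ 2 := by positivity
    linarith
  have hC : 0 < K / m := div_pos (hm0.trans_le hmK) hm0
  refine ⟨K / m, hC, fun L₂ ν Tp Tm hL₂ hν hT => ?_⟩
  have main : ∀ (T : EReal) (ρp ρm V : ℝ → TwoFluid.L2Cyl L₁ L₂),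
      TwoFluid.IsSolution ν Tp Tm T ρp ρm V → ∀ t : ℝ, 0 ≤ t → (t : EReal) < T →
        TwoFluid.distSq (ρp t) (ρm t) ≤ K / m * TwoFluid.distSq (ρp 0) (ρm 0) *
          Real.exp (-(2 * Real.pi ^ 2 * ν / L₁ ^ 2) * t) := by
    intro T ρp ρm V hsol t ht htT
    -- The decay lemma covers only positive times; at t = 0 the bound holds because K/m ≥ 1.
    rcases ht.eq_or_lt with rfl | ht
    · rw [mul_zero, Real.exp_zero, mul_one]
      exact le_mul_of_one_le_left (TwoFluid.distSq_nonneg _ _) ((one_le_div hm0).2 hmK)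
    · have := hsol.decay hL₁ hL₂ hν (hT ▸ hc1) hcμ ht htT
      have e : 2 * Real.pi ^ 2 * ν / L₁ ^ 2 = 2 * (Real.pi / L₁) ^ 2 * ν := by ring
      rw [e, div_mul_eq_mul_div, div_mul_eq_mul_div, le_div_iff₀ hm0, mul_comm _ m]
      exact this
  have hrate : 0 < 2 * Real.pi ^ 2 * ν / L₁ ^ 2 := by positivity
  refine ⟨⟨TwoFluid.isSolution_rhoSS hL₁ hL₂ ν Tp Tm, fun ε hε => ?_, fun ρp ρm V hsol => ?_⟩, main⟩
  · refine ⟨ε / (K / m), by positivity, fun T ρp ρm V hsol h0 t ht htT => ?_⟩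
    have hexp : Real.exp (-(2 * Real.pi ^ 2 * ν / L₁ ^ 2) * t) ≤ 1 :=
      Real.exp_le_one_iff.2 (by rw [neg_mul]; exact neg_nonpos.2 (mul_nonneg hrate.le ht))
    calc _ ≤ _ := main T ρp ρm V hsol t ht htT
      _ ≤ K / m * TwoFluid.distSq (ρp 0) (ρm 0) :=
        mul_le_of_le_one_right (mul_nonneg hC.le (TwoFluid.distSq_nonneg _ _)) hexp
      _ < ε := by rwa [lt_div_iff₀' hC] at h0
  · have hlim : Tendsto (fun t : ℝ => K / m * TwoFluid.distSq (ρp 0) (ρm 0) *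
        Real.exp (-(2 * Real.pi ^ 2 * ν / L₁ ^ 2) * t)) atTop (𝓝 0) := by
      have hexp : Tendsto (fun t : ℝ => Real.exp (-(2 * Real.pi ^ 2 * ν / L₁ ^ 2) * t)) atTop
          (𝓝 0) :=
        Real.tendsto_exp_atBot.comp
          (tendsto_id.const_mul_atTop_of_neg (neg_lt_zero.2 hrate))
      simpa using hexp.const_mul (K / m * TwoFluid.distSq (ρp 0) (ρm 0))
    refine squeeze_zero' (Eventually.of_forall fun t => TwoFluid.distSq_nonneg _ _) ?_ hlim
    filter_upwards [eventually_ge_atTop 0] with t ht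
    exact main ⊤ ρp ρm V hsol t ht (EReal.coe_lt_top t)
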